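/- Let $n\ge 1$, $1<p<\infty$, let $D\subset\mathbb R^n$ be a bounded Lipschitz domain, $D^C=\mathbb R^n\setminus \overline D$, $\iota>0$, and let $\varphi:\partial D\to(0,\infty)$ be Lipschitz continuous. Let $\mathcal A:D^C\times\mathbb R^n\to\mathbb R^n$ be a measurable $p$-degenerate elliptic map: $\mathcal A(\cdot,\xi)$ is measurable for every $\xi$, and there are constants $0<\lambda_0\le\Lambda_0$ such that for a.e. $X\in D^C$ the map $\mathcal A(X,\cdot)$ is continuous and, for all $\xi,\xi_1\ne\xi_2\in\mathbb R^n$ and $\alpha\in\mathbb R$, $$\mathcal A(X,\xi)\cdot\xi\ge\lambda_0|\xi|^p,\quad |\mathcal A(X,\xi)|\le\Lambda_0|\xi|^{p-1},\quad \langle\mathcal A(X,\xi_1)-\mathcal A(X,\xi_2),\xi_1-\xi_2\rangle>0,\quad \mathcal A(X,\alpha\xi)=\alpha|\alpha|^{p-2}\mathcal A(X,\xi).$$ Let $\Gamma:\partial D\times\mathbb R\to\mathbb R$ be such that: for each $X$, $\Gamma(X,\cdot)$ is convex, differentiable and strictly increasing; for each $t$, $\partial_t\Gamma(\cdot,t)$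 is continuous on $\partial D$; if $\Gamma(X_0,t_0)=0$ for some $X_0$ then $\Gamma(Y,t_0)=0$ for all $Y\in\partial D$; and there is $L>0$ with $\Gamma(Y,t)/\Gamma(X,t)\le L$ for all $X,Y\in\partial D$ and all $t$ with $\Gamma(X,t)\ne0$. A configuration is an open set $\Omega\supset\overline D$ with $\mathscr L^n(\Omega\setminus D)<\infty$. Its $\mathcal A$-potential is the weak solution $u\in W^{1,p}(D^C)$ of $$\mathrm{div}\,\mathcal A(X,\nabla u)=0\ \text{in }\Omega\setminus\overline D,\qquad u=\varphi\ \text{on }\partial D,\qquad u=0\ \text{on }\partial\Omega,$$ extended by $0$ outside $\Omega$; the boundary conditions mean that $u-\Phi\in W^{1,p}_0(\Omega\setminus\overline D)$ for some Lipschitz $\Phi$ that is compactly supported in $\Omega$ and equal to $\varphi$ on $\partial D$. Its conormal derivative $\partial_{\mathcal A}u=\langle\mathcal A(X,\nabla u),\mu\rangle$ on $\partial D$, where $\mu$ is the normal of $\partial D$ pointing into $D$, is understood weakly: it is the function in $L^1(\partial D,\mathcal H^{n-1})$, if there is one, such that $$\int_{D^C}\langle\mathcal A(X,\nabla u),\nabla\psi\rangle\,dX=\int_{\partial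 D}\psi\,\partial_{\mathcal A}u\,d\mathcal H^{n-1}\qquad\text{for all }\psi\in C_c^\infty(\Omega).$$ The configuration $\Omega$ has finite flux if $\partial_{\mathcal A}u$ exists and $\Gamma(\cdot,\partial_{\mathcal A}u)\in L^1(\partial D,\mathcal H^{n-1})$. For $\lambda>0$ an optimal configuration of the penalized problem is one that minimizes $$\mathfrak J_\lambda(\Omega)=\int_{\partial D}\Gamma(X,\partial_{\mathcal A}u(X))\,d\mathcal H^{n-1}(X)+\lambda\big(\mathscr L^n(\Omega\setminus D)-\iota\big)^+$$ among all configurations of finite flux. Assume that there is at least one configuration $\mathcal O$ of finite flux with $\mathscr L^n(\mathcal O\setminus D)\le\iota$. Then there is a constant $C>0$, depending only on the data $n,p,\mathcal A,\Gamma,D,\varphi,\iota$ and not on $\lambda$, such that for every $\lambda>0$ and every optimal configuration $\Omega^\star_\lambda$ of the penalized problem, its $\mathcal A$-potential $u^\star_\lambda$ satisfies $$\int_{D^C}|\nabla u_\lambda^\star|^p\,dX<C.$$ -/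

import Mathlib

open MeasureTheory Set Filter Topology
open scoped ENNReal NNReal ContDiff Gradient

noncomputable section

namespace OptimalDesign

/-- Euclidean space of dimension `n`. -/
abbrev E (n : ℕ) : Type := EuclideanSpace ℝ (Fin n)

/-- `ψ ∈ C_c^∞(U)`. -/
def IsTest {n : ℕ} (U : Set (E n)) (ψ : E n → ℝ) : Prop :=
  ContDiff ℝ ∞ ψ ∧ HasCompactSupport ψ ∧ tsupport ψ ⊆ U

/-- `G` is the weak (distributional) gradient of `u` in the open set `U`. -/
def HasWeakGradientOn {n : ℕ} (U : Set (E n)) (u : E n → ℝ) (G : E n → E n) : Prop :=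
  ∀ ψ : E n → ℝ, IsTest U ψ → ∀ v : E n,
    ∫ x in U, u x * inner ℝ (∇ ψ x) v = -∫ x in U, inner ℝ (G x) v * ψ x

/-- `u ∈ W^{1,p}(U)`, with weak gradient `G`. -/
structure MemSobolev {n : ℕ} (U : Set (E n)) (p : ℝ) (u : E n → ℝ) (G : E n → E n) :
    Prop where
  memLp : MemLp u (ENNReal.ofReal p) (volume.restrict U)
  memLp_grad : MemLp G (ENNReal.ofReal p) (volume.restrict U)
  weakGrad : HasWeakGradientOn U u G

/-- `f ∈ W^{1,p}_0(U)`, with weak gradient `g`: the pair `(f, g)` is the limit in `L^p(U)` of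
`(ψ k, ∇ (ψ k))` for some test functions `ψ k ∈ C_c^∞(U)`. -/
def MemSobolevZero {n : ℕ} (U : Set (E n)) (p : ℝ) (f : E n → ℝ) (g : E n → E n) : Prop :=
  ∃ ψ : ℕ → E n → ℝ, (∀ k, IsTest U (ψ k)) ∧
    Tendsto (fun k => eLpNorm (fun x => f x - ψ k x) (ENNReal.ofReal p) (volume.restrict U))
      atTop (𝓝 0) ∧
    Tendsto (fun k => eLpNorm (fun x => g x - ∇ (ψ k) x) (ENNReal.ofReal p) (volume.restrict U))
      atTop (𝓝 0)

/-- `D` is a bounded Lipschitz domain: open, connected, non-empty, bounded, and near each of its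
boundary points the region strictly below the graph, over the hyperplane orthogonal to some unit
vector `e`, of a Lipschitz function `γ`. (A function on that hyperplane is the same thing as a
function on the whole space that is constant along `e`.) -/
structure IsLipschitzDomain {n : ℕ} (D : Set (E n)) : Prop where
  isOpen : IsOpen D
  isConnected : IsConnected D
  isBounded : Bornology.IsBounded D
  lipschitz : ∀ x ∈ frontier D, ∃ r > 0, ∃ e : E n, ‖e‖ = 1 ∧ ∃ K : ℝ≥0, ∃ γ : E n → ℝ,
    LipschitzWith K γ ∧ (∀ (y : E n) (t : ℝ), γ (y + t • e) = γ y) ∧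
    D ∩ Metric.ball x r = {y ∈ Metric.ball x r | inner ℝ y e < γ y}

/-- The exterior domain `Dᶜ`, as an open set. -/
def exterior {n : ℕ} (D : Set (E n)) : Set (E n) := (closure D)ᶜ

/-- The surface measure (normalized `(n-1)`-dimensional Hausdorff measure) on `∂D`. -/
def surface {n : ℕ} (D : Set (E n)) : Measure (E n) :=
  (Measure.euclideanHausdorffMeasure (n - 1)).restrict (frontier D)

/-- `A` is a measurable `p`-degenerate elliptic map on `Dᶜ`. -/
structure IsDegenerateElliptic {n : ℕ} (D : Set (E n)) (p : ℝ) (A : E n → E n → E n) :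
    Prop where
  measurable : ∀ ξ, AEMeasurable (fun x => A x ξ) (volume.restrict (exterior D))
  continuous : ∀ᵐ x ∂(volume.restrict (exterior D)), Continuous (A x)
  elliptic : ∃ l L : ℝ, 0 < l ∧ l ≤ L ∧ ∀ᵐ x ∂(volume.restrict (exterior D)), ∀ ξ,
    l * ‖ξ‖ ^ p ≤ inner ℝ (A x ξ) ξ ∧ ‖A x ξ‖ ≤ L * ‖ξ‖ ^ (p - 1)
  monotone : ∀ᵐ x ∂(volume.restrict (exterior D)), ∀ ξ₁ ξ₂, ξ₁ ≠ ξ₂ →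
    0 < inner ℝ (A x ξ₁ - A x ξ₂) (ξ₁ - ξ₂)
  homogeneous : ∀ᵐ x ∂(volume.restrict (exterior D)), ∀ (a : ℝ) (ξ : E n),
    A x (a • ξ) = (a * |a| ^ (p - 2)) • A x ξ

/-- The structural assumptions on the nonlinearity `Γ : ∂D × ℝ → ℝ`. -/
structure IsNonlinearity {n : ℕ} (D : Set (E n)) (Γ : E n → ℝ → ℝ) : Prop where
  convex : ∀ x ∈ frontier D, ConvexOn ℝ univ (Γ x)
  strictMono : ∀ x ∈ frontier D, StrictMono (Γ x)
  differentiable : ∀ x ∈ frontier D, Differentiable ℝ (Γ x)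
  continuousOn_deriv : ∀ t, ContinuousOn (fun x => deriv (Γ x) t) (frontier D)
  zero : ∀ x ∈ frontier D, ∀ t, Γ x t = 0 → ∀ y ∈ frontier D, Γ y t = 0
  ratio : ∃ L > 0, ∀ x ∈ frontier D, ∀ y ∈ frontier D, ∀ t, Γ x t ≠ 0 → Γ y t / Γ x t ≤ L

/-- A configuration surrounding `D`: an open set containing `closure D` (so that `∂Ω` and `∂D` are
disjoint) for which the volume of `Ω \ D` is finite. -/
structure IsConfiguration {n : ℕ} (D Ω : Set (E n)) : Prop where
  isOpen : IsOpen Ω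
  closure_subset : closure D ⊆ Ω
  volume_lt_top : volume (Ω \ D) < ⊤

/-- `u`, with weak gradient `G`, is the `A`-potential of `Ω`, extended by zero outside `Ω`: the
weak solution of `div A(x, ∇u) = 0` in `Ω \ closure D`, `u = φ` on `∂D`, `u = 0` on `∂Ω`. The
boundary conditions say that `u - Φ ∈ W^{1,p}_0(Ω \ closure D)`, where `Φ` is Lipschitz, compactly
supported in `Ω`, and equal to `φ` on `∂D`. -/
structure IsPotential {n : ℕ} (D : Set (E n)) (p : ℝ) (A : E n → E n → E n) (φ : E n → ℝ)
    (Ω : Set (E n)) (u : E n → ℝ) (G : E n → E n) : Prop where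
  memSobolev : MemSobolev (exterior D) p u G
  zero_outside : ∀ᵐ x ∂volume, x ∉ Ω → u x = 0
  boundary : ∃ Φ : E n → ℝ, (∃ K : ℝ≥0, LipschitzWith K Φ) ∧ HasCompactSupport Φ ∧
    tsupport Φ ⊆ Ω ∧ (∀ x ∈ frontier D, Φ x = φ x) ∧
    MemSobolevZero (Ω \ closure D) p (fun x => u x - Φ x) (fun x => G x - ∇ Φ x)
  equation : ∀ ψ : E n → ℝ, IsTest (Ω \ closure D) ψ →
    ∫ x in exterior D, inner ℝ (A x (G x)) (∇ ψ x) = 0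

/-- `g = ∂_A u` on `∂D`, where `∇u = G`. This is `⟨A(x, ∇u), μ⟩`, `μ` being the unit normal of `∂D`
that points into `D` (the outward normal of the exterior), understood through the divergence
theorem, because `∇u` need not have pointwise boundary values: an integrable `g` on `∂D` with
`∫_{Dᶜ} ⟨A(x, ∇u), ∇ψ⟩ = ∫_{∂D} ψ g` for all `ψ ∈ C_c^∞(Ω)`. -/
structure IsConormalDerivative {n : ℕ} (D : Set (E n)) (A : E n → E n → E n)
    (Ω : Set (E n)) (G : E n → E n) (g : E n → ℝ) : Prop where
  integrable : Integrable g (surface D)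
  divergence : ∀ ψ : E n → ℝ, IsTest Ω ψ →
    ∫ x in exterior D, inner ℝ (A x (G x)) (∇ ψ x) = ∫ x, ψ x * g x ∂(surface D)

/-- `Ω` is a configuration with a well defined finite flux, which has the value
`j = ∫_{∂D} Γ(x, ∂_A u(x)) dH^{n-1}`, where `u` is the `A`-potential of `Ω`. -/
def HasFlux {n : ℕ} (D : Set (E n)) (p : ℝ) (A : E n → E n → E n) (φ : E n → ℝ)
    (Γ : E n → ℝ → ℝ) (Ω : Set (E n)) (j : ℝ) : Prop :=
  IsConfiguration D Ω ∧ ∃ (u : E n → ℝ) (G : E n → E n) (g : E n → ℝ),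
    IsPotential D p A φ Ω u G ∧ IsConormalDerivative D A Ω G g ∧
    Integrable (fun x => Γ x (g x)) (surface D) ∧ j = ∫ x, Γ x (g x) ∂(surface D)

/-- The penalty term `lam * (t - ι)⁺`. -/
def penalty (lam ι t : ℝ) : ℝ := lam * max (t - ι) 0

/-- `Ω` is an optimal configuration of the penalized problem: it minimizes
`J_lam(Ω) = J(Ω) + lam * (|Ω \ D| - ι)⁺`. Configurations whose flux is not finite do not compete. -/
def IsOptimal {n : ℕ} (D : Set (E n)) (p : ℝ) (A : E n → E n → E n) (φ : E n → ℝ)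
    (Γ : E n → ℝ → ℝ) (ι lam : ℝ) (Ω : Set (E n)) : Prop :=
  ∃ j, HasFlux D p A φ Γ Ω j ∧ ∀ (Ω' : Set (E n)) (j' : ℝ), HasFlux D p A φ Γ Ω' j' →
    j + penalty lam ι (volume (Ω \ D)).toReal ≤ j' + penalty lam ι (volume (Ω' \ D)).toReal

end OptimalDesign

end

/-!
The energy of a potential is `∫ ⟨A(x, ∇u), ∇u⟩ = ∫_{∂D} φ ∂_A u`
(`IsPotential.integral_inner_self`), so by ellipticity it suffices to bound the positive part of
the conormal derivative in `L¹(∂D)`. Comparing an optimal configuration with the given admissible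
configuration `O`, whose penalty is zero, shows that `∫ Γ(x, ∂_A u)` is at most the flux of `O`,
whatever `lam` is. The derivative `∂_t Γ(·, 0)` is positive and continuous on the compact set
`∂D`, so by convexity (`IsNonlinearity.exists_coercive`) this bounds the positive part of `∂_A u`
by its negative part and by the data.

The negative part is bounded for every configuration, optimal or not
(`exists_bound_integral_negPart`). If `u` and `v` are the potentials of `Ω` and `O`, they agree on
`∂D`, and Kato's inequality holds up to `∂D`: testing the two equations with `ζ η(u - v)`, where
`η` is a smooth step that vanishes near `0`, gives
`∫_{v < u} ⟨A(x, ∇u) - A(x, ∇v), ∇ζ⟩ ≤ 0` for `ζ ≥ 0`, because of the monotonicity of `A`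
(`IsPotential.integral_step_mul_inner_le_zero`). This is used with `u` and `v` exchanged for a test
function `ζ = ψ`, and as it stands for `ζ = χ - ψ`, where `χ ≥ ψ` is a cutoff function equal to
`1` near `D`. As the gradients agree on `{u = v}`, it follows that
`∫ ψ (∂_A u - ∂_A v) ≥ -∫ |⟨A(x, ∇u) - A(x, ∇v), ∇χ⟩|` (`IsPotential.neg_integral_abs_le`). The
right-hand side only involves the potentials away from `∂D`, where the Caccioppoli inequality and
the maximum principle bound it independently of `Ω` (`exists_cutoff_bound`). Letting `ψ` approach
the indicator function of `{∂_A u < 0}` bounds the negative part.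

All test functions have the form `ζ h(u, v)` with `h` continuously differentiable and `ζ` smooth.
They are admissible because potentials are limits of Lipschitz functions `U k` with the right
support and boundary values (`IsPotential.exists_isApprox`), because the equations may be tested
with Lipschitz functions (`integral_inner_gradient_eq_of_lipschitz`), and because the chain rule
passes to the limit in `ζ h(U k, V k)` (`tendsto_integral_inner_gradient_outer`).
-/

namespace OptimalDesign

variable {n : ℕ}

/-! ### Mollification of Lipschitz functions -/

lemma inner_gradient_eq (f : E n → ℝ) (x v : E n) : inner ℝ (∇ f x) v = fderiv ℝ f x v := by
  simp [gradient]

lemma norm_gradient_eq (f : E n → ℝ) (x : E n) : ‖∇ f x‖ = ‖fderiv ℝ f x‖ := by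
  simp [gradient]

lemma measurable_gradient (f : E n → ℝ) : Measurable (∇ f) :=
  (InnerProductSpace.toDual ℝ (E n)).symm.continuous.measurable.comp (measurable_fderiv ℝ f)

lemma continuous_gradient {ζ : E n → ℝ} (hζ : ContDiff ℝ 1 ζ) : Continuous (∇ ζ) :=
  (InnerProductSpace.toDual ℝ (E n)).symm.continuous.comp (hζ.continuous_fderiv one_ne_zero)

lemma norm_gradient_le {f : E n → ℝ} {K : ℝ≥0} (hf : LipschitzWith K f) (x : E n) :
    ‖∇ f x‖ ≤ K := by
  rw [norm_gradient_eq]; exact norm_fderiv_le_of_lipschitz ℝ hf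

lemma gradient_of_notMem_tsupport {f : E n → ℝ} {x : E n} (hx : x ∉ tsupport f) :
    ∇ f x = 0 := by
  have : fderiv ℝ f x = 0 := fderiv_of_notMem_tsupport (𝕜 := ℝ) hx
  simp [gradient, this]

lemma tendsto_const_div_add_one (c : ℝ) :
    Tendsto (fun k : ℕ => c / ((k : ℝ) + 1)) atTop (𝓝 0) := by
  refine ((tendsto_const_div_atTop_nhds_zero_nat c).comp (tendsto_add_atTop_nat 1)).congr ?_
  intro k
  simp

/-- A Lipschitz function with compact support in an open set is approximated by test functions
there, uniformly, with uniformly bounded gradients that converge almost everywhere. -/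
lemma exists_mollification {F : E n → ℝ} {K : ℝ≥0} (hF : LipschitzWith K F)
    (hc : HasCompactSupport F) {U : Set (E n)} (hU : IsOpen U) (hsub : tsupport F ⊆ U) :
    ∃ (ψ : ℕ → E n → ℝ) (S : Set (E n)) (c : ℝ), IsCompact S ∧ (∀ k, IsTest U (ψ k)) ∧
      (∀ k, tsupport (ψ k) ⊆ S) ∧ (∀ k x, ‖∇ (ψ k) x‖ ≤ K) ∧
      (∀ (k : ℕ) x, |ψ k x - F x| ≤ c / (k + 1)) ∧
      ∀ᵐ x ∂(volume : Measure (E n)), Tendsto (fun k => ∇ (ψ k) x) atTop (𝓝 (∇ F x)) := by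
  obtain ⟨δ, hδ, hδU⟩ := hc.isCompact.exists_cthickening_subset_open hU hsub
  let η : ℕ → ContDiffBump (0 : E n) := fun k =>
    ⟨δ / (k + 1) / 2, δ / (k + 1), by positivity, by
      have : 0 < δ / ((k : ℝ) + 1) := by positivity
      linarith⟩
  have hηout : ∀ k, (η k).rOut = δ / (k + 1) := fun k => rfl
  have hηin : ∀ k, (η k).rIn = δ / (k + 1) / 2 := fun k => rfl
  have hFc : Continuous F := hF.continuous
  have hFl : LocallyIntegrable F (volume : Measure (E n)) := hFc.locallyIntegrable
  let ψ : ℕ → E n → ℝ := fun k =>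
    convolution ((η k).normed volume) F (ContinuousLinearMap.lsmul ℝ ℝ) volume
  have hsupp : ∀ k, tsupport (ψ k) ⊆ Metric.cthickening δ (tsupport F) := by
    intro k
    refine closure_minimal ?_ Metric.isClosed_cthickening
    refine (support_convolution_subset _).trans ?_
    rw [(η k).support_normed_eq]
    rintro _ ⟨a, ha, b, hb, rfl⟩
    refine Metric.mem_cthickening_of_dist_le (a + b) b δ _ (subset_tsupport _ hb) ?_
    have h1 : ‖a‖ < (η k).rOut := by simpa using ha
    have h2 : δ / ((k : ℝ) + 1) ≤ δ := div_le_self hδ.le (by linarith [k.cast_nonneg (α := ℝ)])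
    simp only [dist_eq_norm, add_sub_cancel_right]
    rw [hηout] at h1
    linarith
  have hScomp : IsCompact (Metric.cthickening δ (tsupport F)) := hc.isCompact.cthickening
  have hfd : ∀ᵐ x ∂(volume : Measure (E n)), DifferentiableAt ℝ F x := hF.ae_differentiableAt
  -- differentiation under the integral: by Rademacher's theorem, `F (· - t)` is differentiable at a
  -- given point for almost every `t`, and the Lipschitz bound dominates the difference quotients
  have hder : ∀ k x, HasFDerivAt (ψ k)
      (∫ t, ((η k).normed volume t) • fderiv ℝ F (x - t)) x := by
    intro k x
    have hint : Integrable ((η k).normed (volume : Measure (E n))) := (η k).integrable_normed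
    refine (hasFDerivAt_integral_of_dominated_loc_of_lip (s := univ)
      (bound := fun t => (η k).normed volume t * K) Filter.univ_mem ?_ ?_ ?_ ?_ ?_ ?_).2
    · refine Eventually.of_forall fun y => ?_
      have : Continuous fun t => ((η k).normed volume t) * F (y - t) :=
        (η k).continuous_normed.mul (hFc.comp (by fun_prop))
      exact this.aestronglyMeasurable
    · have h1 : Continuous fun t => ((η k).normed volume t) * F (x - t) :=
        (η k).continuous_normed.mul (hFc.comp (by fun_prop))
      exact h1.integrable_of_hasCompactSupport ((η k).hasCompactSupport_normed.mul_right)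
    · refine AEStronglyMeasurable.smul (η k).continuous_normed.aestronglyMeasurable ?_
      exact ((measurable_fderiv ℝ F).comp (measurable_const.sub measurable_id)).aestronglyMeasurable
    · refine Eventually.of_forall fun t => LipschitzOnWith.of_dist_le_mul fun y _ z _ => ?_
      have h0 := (η k).nonneg_normed (μ := volume) t
      have h1 := hF.dist_le_mul (y - t) (z - t)
      simp only [dist_sub_right] at h1
      simp only [Real.dist_eq, ContinuousLinearMap.lsmul_apply, smul_eq_mul, ← mul_sub, abs_mul,
        Real.coe_nnabs, abs_of_nonneg h0] at h1 ⊢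
      rw [abs_of_nonneg K.coe_nonneg, mul_assoc]
      exact mul_le_mul_of_nonneg_left h1 h0
    · exact hint.mul_const _
    · have h1 : ∀ᵐ t ∂(volume : Measure (E n)), DifferentiableAt ℝ F (x - t) :=
        (Measure.measurePreserving_sub_left volume x).quasiMeasurePreserving.ae hfd
      filter_upwards [h1] with t ht
      have h2 : HasFDerivAt (fun y => F (y - t)) (fderiv ℝ F (x - t)) x := by
        have h3 := ht.hasFDerivAt.comp x ((hasFDerivAt_id x).sub_const t)
        rwa [ContinuousLinearMap.comp_id] at h3
      exact h2.const_smul ((η k).normed volume t)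
  have hfl : LocallyIntegrable (fderiv ℝ F) (volume : Measure (E n)) := by
    refine (locallyIntegrable_const (K : ℝ)).mono
      (measurable_fderiv ℝ F).aestronglyMeasurable (Eventually.of_forall fun x => ?_)
    simpa using norm_fderiv_le_of_lipschitz ℝ hF
  have hlim := ContDiffBump.ae_convolution_tendsto_right_of_locallyIntegrable
    (φ := η) (l := atTop) (K := 2) (μ := (volume : Measure (E n))) (g := fderiv ℝ F)
    (tendsto_const_div_add_one δ)
    (Eventually.of_forall fun k => by rw [hηout, hηin]; linarith) hfl
  refine ⟨ψ, _, K * δ, hScomp, fun k => ⟨?_, ?_, (hsupp k).trans hδU⟩, hsupp, ?_, ?_, ?_⟩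
  · exact (η k).hasCompactSupport_normed.contDiff_convolution_left _ (η k).contDiff_normed hFl
  · exact hScomp.of_isClosed_subset (isClosed_tsupport _) (hsupp k)
  · intro k x
    rw [norm_gradient_eq, (hder k x).fderiv]
    calc ‖∫ t, ((η k).normed volume t) • fderiv ℝ F (x - t)‖
        ≤ ∫ t, (η k).normed volume t * K := by
          refine norm_integral_le_of_norm_le ((η k).integrable_normed.mul_const _)
            (Eventually.of_forall fun t => ?_)
          rw [norm_smul, Real.norm_of_nonneg ((η k).nonneg_normed t)]
          exact mul_le_mul_of_nonneg_left (norm_fderiv_le_of_lipschitz ℝ hF)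
            ((η k).nonneg_normed t)
      _ = K := by rw [integral_mul_const, (η k).integral_normed, one_mul]
  · intro k x
    rw [← Real.dist_eq]
    refine ContDiffBump.dist_normed_convolution_le hFc.aestronglyMeasurable fun y hy => ?_
    refine (hF.dist_le_mul y x).trans ?_
    rw [mul_div_assoc]
    exact mul_le_mul_of_nonneg_left (by simpa [hηout] using (Metric.mem_ball.1 hy).le) K.coe_nonneg
  · filter_upwards [hlim] with x hx
    have h1 : ∀ k, ∇ (ψ k) x = (InnerProductSpace.toDual ℝ (E n)).symm
        (convolution ((η k).normed volume) (fderiv ℝ F) (ContinuousLinearMap.lsmul ℝ ℝ)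
          volume x) := by
      intro k
      rw [gradient, (hder k x).fderiv]
      rfl
    simp only [h1]
    exact ((InnerProductSpace.toDual ℝ (E n)).symm.continuous.tendsto _).comp hx

/-- An integral identity against test functions in `U` extends to Lipschitz functions with
compact support in `U`. -/
lemma integral_inner_gradient_eq_of_lipschitz {U V : Set (E n)} (hU : IsOpen U)
    {Y : E n → E n} (hY : ∀ S, IsCompact S → IntegrableOn Y S (volume.restrict V))
    {σ : Measure (E n)} {g : E n → ℝ} (hg : Integrable g σ)
    (h : ∀ ψ, IsTest U ψ → ∫ x in V, inner ℝ (Y x) (∇ ψ x) = ∫ x, ψ x * g x ∂σ)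
    {F : E n → ℝ} {K : ℝ≥0} (hF : LipschitzWith K F)
    (hc : HasCompactSupport F) (hsub : tsupport F ⊆ U) :
    ∫ x in V, inner ℝ (Y x) (∇ F x) = ∫ x, F x * g x ∂σ := by
  obtain ⟨ψ, S, c, hS, hψ, hψS, hψK, hψF, hlim⟩ := exists_mollification hF hc hU hsub
  have hYS := hY S hS
  have hYS' : Integrable (S.indicator Y) (volume.restrict V) :=
    (integrable_indicator_iff hS.measurableSet).2 hYS
  have h1 : Tendsto (fun k => ∫ x in V, inner ℝ (Y x) (∇ (ψ k) x)) atTop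
      (𝓝 (∫ x in V, inner ℝ (Y x) (∇ F x))) := by
    have hlim' : ∀ᵐ x ∂(volume.restrict V), Tendsto (fun k => ∇ (ψ k) x) atTop (𝓝 (∇ F x)) :=
      ae_restrict_of_ae hlim
    have heq : ∀ k x, inner ℝ (Y x) (∇ (ψ k) x) = inner ℝ (S.indicator Y x) (∇ (ψ k) x) := by
      intro k x
      by_cases hx : x ∈ S
      · simp [hx]
      · simp [gradient_of_notMem_tsupport fun hx' => hx (hψS k hx')]
    simp only [heq]
    refine tendsto_integral_of_dominated_convergence (fun x => ‖S.indicator Y x‖ * K)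
      (fun k => ?_) (hYS'.norm.mul_const _) (fun k => Eventually.of_forall fun x => ?_) ?_
    · exact hYS'.aestronglyMeasurable.inner (measurable_gradient _).aestronglyMeasurable
    · exact (norm_inner_le_norm _ _).trans (mul_le_mul_of_nonneg_left (hψK k x) (norm_nonneg _))
    · filter_upwards [hlim'] with x hx
      have h2 : Tendsto (fun k => inner ℝ (Y x) (∇ (ψ k) x)) atTop (𝓝 (inner ℝ (Y x) (∇ F x))) :=
        tendsto_const_nhds.inner hx
      simpa only [heq] using h2
  have h2 : Tendsto (fun k => ∫ x, ψ k x * g x ∂σ) atTop (𝓝 (∫ x, F x * g x ∂σ)) := by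
    obtain ⟨B, hB⟩ := hc.exists_bound_of_continuous hF.continuous
    have hc0 : 0 ≤ c := by
      have := (abs_nonneg _).trans (hψF 0 0)
      simpa using this
    refine tendsto_integral_of_dominated_convergence (fun x => (B + c) * ‖g x‖)
      (fun k => ?_) (hg.norm.const_mul _) (fun k => Eventually.of_forall fun x => ?_)
      (Eventually.of_forall fun x => ?_)
    · exact (hψ k).1.continuous.aestronglyMeasurable.mul hg.aestronglyMeasurable
    · rw [norm_mul]
      refine mul_le_mul_of_nonneg_right ?_ (norm_nonneg _)
      have h3 := hψF k x
      have h4 : c / ((k : ℝ) + 1) ≤ c := div_le_self hc0 (by linarith [k.cast_nonneg (α := ℝ)])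
      have h5 := hB x
      rw [Real.norm_eq_abs] at h5 ⊢
      calc |ψ k x| = |F x + (ψ k x - F x)| := by ring_nf
        _ ≤ |F x| + |ψ k x - F x| := abs_add_le _ _
        _ ≤ B + c := by linarith
    · refine Tendsto.mul_const _ ?_
      rw [tendsto_iff_dist_tendsto_zero]
      refine squeeze_zero (fun _ => dist_nonneg) (fun k => ?_)
        (tendsto_const_div_add_one c)
      simpa [Real.dist_eq] using hψF k x
  exact tendsto_nhds_unique h1 (h2.congr fun k => (h _ (hψ k)).symm)

/-- The gradient of a compactly supported Lipschitz function has mean zero. -/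
lemma integral_inner_gradient_eq_zero {F : E n → ℝ} {K : ℝ≥0} (hF : LipschitzWith K F)
    (hc : HasCompactSupport F) (v : E n) : ∫ x, inner ℝ v (∇ F x) = 0 := by
  have h := LipschitzWith.integral_lineDeriv_mul_eq (μ := (volume : Measure (E n)))
    (LipschitzWith.const (1 : ℝ)) hF hc (-v)
  simp only [neg_neg, mul_one] at h
  have h0 : ∀ x : E n, lineDeriv ℝ (fun _ : E n => (1 : ℝ)) x (-v) = 0 := fun x => by
    simp [lineDeriv]
  simp only [h0, zero_mul, integral_zero] at h
  rw [h]
  refine integral_congr_ae ?_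
  filter_upwards [hF.ae_differentiableAt (μ := (volume : Measure (E n)))] with x hx
  rw [real_inner_comm, inner_gradient_eq, hx.lineDeriv_eq_fderiv]

/-! ### Sobolev limits of Lipschitz functions and outer functions of two of them -/

section Convergence

variable {P Q : ℝ≥0∞} {μ : Measure (E n)}

lemma integrable_inner_of_memLp [Q.HolderTriple P 1] {Y Z : E n → E n} (hY : MemLp Y Q μ)
    (hZ : MemLp Z P μ) : Integrable (fun x => inner ℝ (Y x) (Z x)) μ := by
  rw [← memLp_one_iff_integrable]
  refine MemLp.of_bilin (fun a b => inner ℝ a b) 1 hY hZ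
    (hY.aestronglyMeasurable.inner hZ.aestronglyMeasurable) (Eventually.of_forall fun x => ?_)
  simpa using nnnorm_inner_le_nnnorm (𝕜 := ℝ) (Y x) (Z x)

/-- Pairing an `L^Q` field with bounded, pointwise convergent multiples of an `L^P`-convergent
sequence of fields passes to the limit. -/
lemma tendsto_integral_inner_smul [Q.HolderTriple P 1] {Y Z : E n → E n} {Zs : ℕ → E n → E n}
    (hY : MemLp Y Q μ) (hZ : MemLp Z P μ) (hZs : ∀ k, MemLp (Zs k) P μ)
    (hlim : Tendsto (fun k => eLpNorm (fun x => Zs k x - Z x) P μ) atTop (𝓝 0))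
    {c : ℕ → E n → ℝ} {c₀ : E n → ℝ} {B : ℝ} (hc : ∀ k, AEStronglyMeasurable (c k) μ)
    (hB : ∀ k x, |c k x| ≤ B)
    (hc₀ : ∀ᵐ x ∂μ, Tendsto (fun k => c k x) atTop (𝓝 (c₀ x))) :
    (∀ k, Integrable (fun x => inner ℝ (Y x) (c k x • Zs k x)) μ) ∧
    Integrable (fun x => inner ℝ (Y x) (c₀ x • Z x)) μ ∧
    Tendsto (fun k => ∫ x, inner ℝ (Y x) (c k x • Zs k x) ∂μ) atTop
      (𝓝 (∫ x, inner ℝ (Y x) (c₀ x • Z x) ∂μ)) := by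
  have hc₀m : AEStronglyMeasurable c₀ μ := aestronglyMeasurable_of_tendsto_ae atTop hc hc₀
  have hB₀ : ∀ᵐ x ∂μ, ‖c₀ x‖ ≤ B := by
    filter_upwards [hc₀] with x hx
    exact le_of_tendsto hx.norm (Eventually.of_forall fun k => hB k x)
  simp only [inner_smul_right]
  have hI : Integrable (fun x => inner ℝ (Y x) (Z x)) μ := integrable_inner_of_memLp hY hZ
  have hIk : ∀ k, Integrable (fun x => inner ℝ (Y x) (Zs k x)) μ :=
    fun k => integrable_inner_of_memLp hY (hZs k)
  have hD : ∀ k, Integrable (fun x => inner ℝ (Y x) (Zs k x - Z x)) μ :=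
    fun k => integrable_inner_of_memLp hY ((hZs k).sub hZ)
  have hcD : ∀ k, Integrable (fun x => c k x * inner ℝ (Y x) (Zs k x - Z x)) μ :=
    fun k => (hD k).bdd_mul (hc k) (Eventually.of_forall fun x => hB k x)
  have hcZ : ∀ k, Integrable (fun x => c k x * inner ℝ (Y x) (Z x)) μ :=
    fun k => hI.bdd_mul (hc k) (Eventually.of_forall fun x => hB k x)
  refine ⟨fun k => (hIk k).bdd_mul (hc k) (Eventually.of_forall fun x => hB k x),
    hI.bdd_mul hc₀m hB₀, ?_⟩
  -- the part with `Zs k - Z` is small by Hölder's inequality, and in the rest only the bounded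
  -- factor depends on `k`
  have hsplit : ∀ k, ∫ x, c k x * inner ℝ (Y x) (Zs k x) ∂μ
      = (∫ x, c k x * inner ℝ (Y x) (Zs k x - Z x) ∂μ) + ∫ x, c k x * inner ℝ (Y x) (Z x) ∂μ := by
    intro k
    rw [← integral_add (hcD k) (hcZ k)]
    refine integral_congr_ae (Eventually.of_forall fun x => ?_)
    simp only [inner_sub_right]
    ring
  simp only [hsplit]
  rw [← zero_add (∫ x, c₀ x * inner ℝ (Y x) (Z x) ∂μ)]
  refine Tendsto.add ?_ ?_
  · rw [tendsto_zero_iff_norm_tendsto_zero]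
    have h0 : Tendsto (fun k => ENNReal.ofReal B * (eLpNorm Y Q μ *
        eLpNorm (fun x => Zs k x - Z x) P μ)) atTop (𝓝 0) := by
      have h1 := ENNReal.Tendsto.const_mul (a := eLpNorm Y Q μ) hlim (Or.inr hY.2.ne)
      have h2 := ENNReal.Tendsto.const_mul (a := ENNReal.ofReal B) h1
        (Or.inr ENNReal.ofReal_ne_top)
      simpa using h2
    have h3 := (ENNReal.tendsto_toReal ENNReal.zero_ne_top).comp h0
    have h4 : ∀ k, ‖∫ x, c k x * inner ℝ (Y x) (Zs k x - Z x) ∂μ‖ₑ ≤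
        ENNReal.ofReal B * (eLpNorm Y Q μ * eLpNorm (fun x => Zs k x - Z x) P μ) := by
      intro k
      calc ‖∫ x, c k x * inner ℝ (Y x) (Zs k x - Z x) ∂μ‖ₑ
          ≤ ∫⁻ x, ‖c k x * inner ℝ (Y x) (Zs k x - Z x)‖ₑ ∂μ := enorm_integral_le_lintegral_enorm _
        _ ≤ ∫⁻ x, ENNReal.ofReal B * ‖(inner ℝ (Y x) (Zs k x - Z x) : ℝ)‖ₑ ∂μ := by
            refine lintegral_mono fun x => ?_
            rw [enorm_mul]
            gcongr
            rw [Real.enorm_eq_ofReal_abs]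
            exact ENNReal.ofReal_le_ofReal (hB k x)
        _ = ENNReal.ofReal B * eLpNorm (fun x => (inner ℝ (Y x) (Zs k x - Z x) : ℝ)) 1 μ := by
            rw [lintegral_const_mul' _ _ ENNReal.ofReal_ne_top, eLpNorm_one_eq_lintegral_enorm]
        _ ≤ _ := by
            gcongr
            have := eLpNorm_le_eLpNorm_mul_eLpNorm_of_nnnorm (p := Q) (q := P) (r := 1) hY.aestronglyMeasurable
              ((hZs k).sub hZ).aestronglyMeasurable (fun a b : E n => (inner ℝ a b : ℝ)) 1
              (Eventually.of_forall fun x => by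
                simpa using nnnorm_inner_le_nnnorm (𝕜 := ℝ) (Y x) ((Zs k - Z) x))
            rw [ENNReal.coe_one, one_mul] at this
            exact this
    have hfin : ∀ k, ENNReal.ofReal B * (eLpNorm Y Q μ *
        eLpNorm (fun x => Zs k x - Z x) P μ) ≠ ⊤ := fun k =>
      ENNReal.mul_ne_top ENNReal.ofReal_ne_top
        (ENNReal.mul_ne_top hY.2.ne ((hZs k).sub hZ).2.ne)
    refine squeeze_zero (fun _ => norm_nonneg _) (fun k => ?_) h3
    rw [← toReal_enorm]
    exact ENNReal.toReal_mono (hfin k) (h4 k)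
  · refine tendsto_integral_of_dominated_convergence (fun x => B * ‖inner ℝ (Y x) (Z x)‖)
      (fun k => (hcZ k).aestronglyMeasurable) (hI.norm.const_mul _)
      (fun k => Eventually.of_forall fun x => ?_) ?_
    · rw [norm_mul]
      exact mul_le_mul_of_nonneg_right (hB k x) (norm_nonneg _)
    · filter_upwards [hc₀] with x hx
      exact hx.mul_const _

/-- `(u, G)` is the limit in `L^P`, and almost everywhere in the first component, of the pairs
`(U k, ∇ (U k))` for compactly supported Lipschitz functions `U k`. -/
structure GradApprox (P : ℝ≥0∞) (μ : Measure (E n)) (u : E n → ℝ) (G : E n → E n)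
    (U : ℕ → E n → ℝ) : Prop where
  lip : ∀ k, ∃ K : ℝ≥0, LipschitzWith K (U k)
  compact : ∀ k, HasCompactSupport (U k)
  memLp : MemLp u P μ
  memLp_grad : MemLp G P μ
  memLp_approx : ∀ k, MemLp (U k) P μ
  memLp_grad_approx : ∀ k, MemLp (∇ (U k)) P μ
  tendsto : Tendsto (fun k => eLpNorm (fun x => U k x - u x) P μ) atTop (𝓝 0)
  tendsto_grad : Tendsto (fun k => eLpNorm (fun x => ∇ (U k) x - G x) P μ) atTop (𝓝 0)
  ae_tendsto : ∀ᵐ x ∂μ, Tendsto (fun k => U k x) atTop (𝓝 (u x))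

/-- `h` is a continuously differentiable function of two real variables that vanishes at the
origin, with partial derivatives `h₁` and `h₂` bounded by `C`. -/
structure IsOuter (h h₁ h₂ : ℝ × ℝ → ℝ) (C : ℝ) : Prop where
  zero : h 0 = 0
  hasFDerivAt : ∀ q, HasFDerivAt h
    (h₁ q • ContinuousLinearMap.fst ℝ ℝ ℝ + h₂ q • ContinuousLinearMap.snd ℝ ℝ ℝ) q
  continuous₁ : Continuous h₁
  continuous₂ : Continuous h₂
  bound₁ : ∀ q, |h₁ q| ≤ C
  bound₂ : ∀ q, |h₂ q| ≤ C

variable {h h₁ h₂ : ℝ × ℝ → ℝ} {C : ℝ}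

lemma IsOuter.nonneg (hh : IsOuter h h₁ h₂ C) : 0 ≤ C := (abs_nonneg _).trans (hh.bound₁ 0)

lemma IsOuter.continuous (hh : IsOuter h h₁ h₂ C) : Continuous h :=
  continuous_iff_continuousAt.2 fun q => (hh.hasFDerivAt q).continuousAt

lemma IsOuter.norm_sub_le (hh : IsOuter h h₁ h₂ C) (q q' : ℝ × ℝ) :
    ‖h q - h q'‖ ≤ 2 * C * ‖q - q'‖ := by
  refine Convex.norm_image_sub_le_of_norm_hasFDerivWithin_le (s := univ)
    (fun x _ => (hh.hasFDerivAt x).hasFDerivWithinAt) (fun x _ => ?_) convex_univ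
    (mem_univ _) (mem_univ _)
  refine (norm_add_le _ _).trans ?_
  rw [norm_smul, norm_smul, two_mul]
  have h1 := ContinuousLinearMap.norm_fst_le ℝ ℝ ℝ
  have h2 := ContinuousLinearMap.norm_snd_le ℝ ℝ ℝ
  exact add_le_add
    (by simpa using mul_le_mul (hh.bound₁ x) h1 (norm_nonneg _) hh.nonneg)
    (by simpa using mul_le_mul (hh.bound₂ x) h2 (norm_nonneg _) hh.nonneg)

lemma IsOuter.norm_sub_le_add (hh : IsOuter h h₁ h₂ C) (a b a' b' : ℝ) :
    ‖h (a, b) - h (a', b')‖ ≤ 2 * C * (‖a - a'‖ + ‖b - b'‖) := by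
  refine (hh.norm_sub_le _ _).trans (mul_le_mul_of_nonneg_left ?_
    (mul_nonneg two_pos.le hh.nonneg))
  rw [Prod.mk_sub_mk, Prod.norm_mk]
  exact max_le (le_add_of_nonneg_right (norm_nonneg _)) (le_add_of_nonneg_left (norm_nonneg _))

lemma IsOuter.lipschitzWith (hh : IsOuter h h₁ h₂ C) : ∃ K : ℝ≥0, LipschitzWith K h :=
  ⟨⟨2 * C, mul_nonneg two_pos.le hh.nonneg⟩, LipschitzWith.of_dist_le_mul fun q q' => by
    rw [dist_eq_norm, dist_eq_norm]; exact hh.norm_sub_le q q'⟩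

lemma IsOuter.gradient_mul_comp (hh : IsOuter h h₁ h₂ C) {ζ U V : E n → ℝ} {x : E n}
    (hζ : DifferentiableAt ℝ ζ x) (hU : DifferentiableAt ℝ U x) (hV : DifferentiableAt ℝ V x) :
    ∇ (fun x => ζ x * h (U x, V x)) x = h (U x, V x) • ∇ ζ x +
      ((ζ x * h₁ (U x, V x)) • ∇ U x + (ζ x * h₂ (U x, V x)) • ∇ V x) := by
  have h1 : HasFDerivAt (fun x => h (U x, V x)) _ x :=
    (hh.hasFDerivAt (U x, V x)).comp x (hU.hasFDerivAt.prodMk hV.hasFDerivAt)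
  have h2 := (hζ.hasFDerivAt.mul h1).fderiv
  refine ext_inner_right ℝ fun v => ?_
  rw [inner_gradient_eq]
  erw [h2]
  simp only [inner_add_left, real_inner_smul_left, inner_gradient_eq,
    add_apply, smul_apply, smul_eq_mul,
    ContinuousLinearMap.comp_apply, ContinuousLinearMap.prod_apply,
    ContinuousLinearMap.coe_fst', ContinuousLinearMap.coe_snd']
  ring

/-- The limit of `∇ (ζ h(U k, V k))`, as a field on the domain: the product and chain rules hold
for the limits `u` and `v`. -/
noncomputable def outerGrad (h h₁ h₂ : ℝ × ℝ → ℝ) (ζ u v : E n → ℝ) (G H : E n → E n) (x : E n) : E n :=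
  h (u x, v x) • ∇ ζ x + ((ζ x * h₁ (u x, v x)) • G x + (ζ x * h₂ (u x, v x)) • H x)

/-- Integrals against the gradients of `ζ h(U k, V k)` converge. -/
lemma tendsto_integral_inner_gradient_outer [Q.HolderTriple P 1]
    (hμ : μ ≪ volume) {Y : E n → E n} (hY : MemLp Y Q μ)
    (hh : IsOuter h h₁ h₂ C) {ζ : E n → ℝ} {B : ℝ} (hζ : ContDiff ℝ 1 ζ)
    (hB : ∀ x, |ζ x| ≤ B) (hB' : ∀ x, ‖∇ ζ x‖ ≤ B)
    {u v : E n → ℝ} {G H : E n → E n} {U V : ℕ → E n → ℝ}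
    (hU : GradApprox P μ u G U) (hV : GradApprox P μ v H V) :
    Integrable (fun x => inner ℝ (Y x) (outerGrad h h₁ h₂ ζ u v G H x)) μ ∧
    Tendsto (fun k => ∫ x, inner ℝ (Y x) (∇ (fun x => ζ x * h (U k x, V k x)) x) ∂μ) atTop
      (𝓝 (∫ x, inner ℝ (Y x) (outerGrad h h₁ h₂ ζ u v G H x) ∂μ)) := by
  have hB0 : 0 ≤ B := (abs_nonneg _).trans (hB 0)
  have hC0 := hh.nonneg
  have hζc : Continuous ζ := hζ.continuous
  have hζgm : AEStronglyMeasurable (∇ ζ) μ := (measurable_gradient ζ).aestronglyMeasurable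
  have hUc : ∀ k, Continuous (U k) := fun k => (hU.lip k).choose_spec.continuous
  have hVc : ∀ k, Continuous (V k) := fun k => (hV.lip k).choose_spec.continuous
  have hpair : ∀ᵐ x ∂μ, Tendsto (fun k => (U k x, V k x)) atTop (𝓝 (u x, v x)) := by
    filter_upwards [hU.ae_tendsto, hV.ae_tendsto] with x h1 h2
    exact h1.prodMk_nhds h2
  -- the term in which the derivative falls on `ζ`
  have hmem : ∀ {a b : E n → ℝ}, MemLp a P μ → MemLp b P μ →
      MemLp (fun x => h (a x, b x) • ∇ ζ x) P μ := by
    intro a b ha hb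
    refine ((ha.norm.add hb.norm).const_mul (2 * C * B)).mono
      ((hh.continuous.comp_aestronglyMeasurable
        (ha.aestronglyMeasurable.prodMk hb.aestronglyMeasurable)).smul hζgm)
      (Eventually.of_forall fun x => ?_)
    have h1 := hh.norm_sub_le_add (a x) (b x) 0 0
    have h0 : h ((0 : ℝ), (0 : ℝ)) = 0 := hh.zero
    rw [h0, sub_zero, sub_zero, sub_zero] at h1
    rw [norm_smul, Pi.add_apply]
    calc ‖h (a x, b x)‖ * ‖∇ ζ x‖ ≤ (2 * C * (‖a x‖ + ‖b x‖)) * B :=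
          mul_le_mul h1 (hB' x) (norm_nonneg _) (by positivity)
      _ = 2 * C * B * (‖a x‖ + ‖b x‖) := by ring
      _ ≤ _ := le_abs_self _
  have hlim1 : Tendsto (fun k => eLpNorm (fun x => h (U k x, V k x) • ∇ ζ x -
      h (u x, v x) • ∇ ζ x) P μ) atTop (𝓝 0) := by
    have hb : ∀ k, eLpNorm (fun x => h (U k x, V k x) • ∇ ζ x - h (u x, v x) • ∇ ζ x) P μ ≤
        ENNReal.ofReal (2 * C * B) * (ENNReal.LpAddConst P *
          (eLpNorm (fun x => U k x - u x) P μ + eLpNorm (fun x => V k x - v x) P μ)) := by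
      intro k
      have h1 : eLpNorm (fun x => h (U k x, V k x) • ∇ ζ x - h (u x, v x) • ∇ ζ x) P μ ≤
          ENNReal.ofReal (2 * C * B) *
            eLpNorm (fun x => ‖U k x - u x‖ + ‖V k x - v x‖) P μ := by
        refine eLpNorm_le_mul_eLpNorm_of_ae_le_mul (Eventually.of_forall fun x => ?_) _
        rw [← sub_smul, norm_smul]
        have h1 := hh.norm_sub_le_add (U k x) (V k x) (u x) (v x)
        calc ‖h (U k x, V k x) - h (u x, v x)‖ * ‖∇ ζ x‖
            ≤ (2 * C * (‖U k x - u x‖ + ‖V k x - v x‖)) * B :=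
              mul_le_mul h1 (hB' x) (norm_nonneg _) (by positivity)
          _ = 2 * C * B * (‖U k x - u x‖ + ‖V k x - v x‖) := by ring
          _ ≤ _ := mul_le_mul_of_nonneg_left (le_abs_self _) (by positivity)
      refine h1.trans ?_
      gcongr
      have h2 := eLpNorm_add_le' (p := P) (μ := μ)
        (((hU.memLp_approx k).sub hU.memLp).aestronglyMeasurable.norm)
        (((hV.memLp_approx k).sub hV.memLp).aestronglyMeasurable.norm)
      rw [eLpNorm_norm, eLpNorm_norm] at h2
      exact h2
    refine tendsto_of_tendsto_of_tendsto_of_le_of_le tendsto_const_nhds ?_ (fun _ => bot_le) hb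
    have h2 := ENNReal.Tendsto.const_mul (a := ENNReal.LpAddConst P) (hU.tendsto.add hV.tendsto)
      (Or.inr (ENNReal.LpAddConst_lt_top P).ne)
    have h3 := ENNReal.Tendsto.const_mul (a := ENNReal.ofReal (2 * C * B)) h2
      (Or.inr ENNReal.ofReal_ne_top)
    simpa using h3
  have t1 := tendsto_integral_inner_smul hY (hmem hU.memLp hV.memLp)
    (fun k => hmem (hU.memLp_approx k) (hV.memLp_approx k)) hlim1
    (c := fun _ _ => 1) (c₀ := fun _ => 1) (B := 1) (fun _ => aestronglyMeasurable_const)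
    (fun _ _ => by simp) (Eventually.of_forall fun _ => tendsto_const_nhds)
  have hcoef : ∀ {f : ℝ × ℝ → ℝ}, Continuous f → (∀ q, |f q| ≤ C) →
      (∀ k, AEStronglyMeasurable (fun x => ζ x * f (U k x, V k x)) μ) ∧
      (∀ k x, |ζ x * f (U k x, V k x)| ≤ B * C) ∧
      ∀ᵐ x ∂μ, Tendsto (fun k => ζ x * f (U k x, V k x)) atTop (𝓝 (ζ x * f (u x, v x))) := by
    intro f hf hfC
    refine ⟨fun k => ?_, fun k x => ?_, ?_⟩
    · exact (hζc.mul (hf.comp ((hUc k).prodMk (hVc k)))).aestronglyMeasurable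
    · rw [abs_mul]
      exact mul_le_mul (hB x) (hfC _) (abs_nonneg _) hB0
    · filter_upwards [hpair] with x hx
      exact ((hf.tendsto _).comp hx).const_mul _
  obtain ⟨m1, b1, l1⟩ := hcoef hh.continuous₁ hh.bound₁
  obtain ⟨m2, b2, l2⟩ := hcoef hh.continuous₂ hh.bound₂
  have t2 := tendsto_integral_inner_smul hY hU.memLp_grad hU.memLp_grad_approx hU.tendsto_grad
    m1 b1 l1
  have t3 := tendsto_integral_inner_smul hY hV.memLp_grad hV.memLp_grad_approx hV.tendsto_grad
    m2 b2 l2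
  simp only [one_smul] at t1
  simp only [outerGrad, inner_add_right]
  refine ⟨t1.2.1.add (t2.2.1.add t3.2.1), ?_⟩
  have e1 := integral_add t1.2.1 (t2.2.1.add t3.2.1)
  have e2 := integral_add t2.2.1 t3.2.1
  simp only [Pi.add_apply] at e1
  rw [e1, e2]
  refine (t1.2.2.add (t2.2.2.add t3.2.2)).congr fun k => ?_
  have e3 := integral_add (t1.1 k) ((t2.1 k).add (t3.1 k))
  have e4 := integral_add (t2.1 k) (t3.1 k)
  simp only [Pi.add_apply] at e3
  rw [← e4, ← e3]
  refine integral_congr_ae ?_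
  obtain ⟨_, hlU⟩ := hU.lip k
  obtain ⟨_, hlV⟩ := hV.lip k
  filter_upwards [hμ.ae_le (hlU.ae_differentiableAt (μ := (volume : Measure (E n)))),
    hμ.ae_le (hlV.ae_differentiableAt (μ := (volume : Measure (E n))))] with x h1 h2
  rw [hh.gradient_mul_comp (hζ.differentiable one_ne_zero x) h1 h2, inner_add_right,
    inner_add_right]

end Convergence

/-! ### Lipschitz test functions on the exterior -/

section Exterior

variable {D Ω : Set (E n)}

lemma isOpen_exterior (D : Set (E n)) : IsOpen (exterior D) := isClosed_closure.isOpen_compl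

lemma exists_frontier_mem_segment {x y : E n} (hx : x ∈ exterior D) (hy : y ∉ exterior D) :
    ∃ z ∈ frontier D, z ∈ segment ℝ x y := by
  by_contra! hcon
  have hpre : IsPreconnected (segment ℝ x y) := (convex_segment x y).isPreconnected
  have hcov : segment ℝ x y ⊆ exterior D ∪ interior (closure D) := by
    intro z hz
    by_cases h : z ∈ closure D
    · right
      by_contra h'
      exact hcon z (frontier_closure_subset ⟨by simpa using h, h'⟩) hz
    · exact Or.inl h
  have hdis : Disjoint (exterior D) (interior (closure D)) :=
    disjoint_compl_left.mono_right interior_subset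
  exact hy (hpre.subset_left_of_subset_union (isOpen_exterior D) isOpen_interior hdis hcov
    ⟨x, left_mem_segment ℝ x y, hx⟩ (right_mem_segment ℝ x y))

/-- A Lipschitz function that vanishes on `∂D` remains Lipschitz when it is replaced by zero
inside `D`. -/
lemma lipschitzWith_indicator_exterior {F : E n → ℝ} {K : ℝ≥0} (hF : LipschitzWith K F)
    (h0 : ∀ x ∈ frontier D, F x = 0) : LipschitzWith K ((exterior D).indicator F) := by
  have key : ∀ x ∈ exterior D, ∀ y ∉ exterior D, |F x| ≤ K * dist x y := by
    intro x hx y hy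
    obtain ⟨z, hz, hzs⟩ := exists_frontier_mem_segment hx hy
    have h1 := hF.dist_le_mul x z
    rw [h0 z hz, Real.dist_eq, sub_zero] at h1
    refine h1.trans (mul_le_mul_of_nonneg_left ?_ K.coe_nonneg)
    have h2 := dist_add_dist_of_mem_segment hzs
    linarith [dist_nonneg (x := z) (y := y)]
  refine LipschitzWith.of_dist_le_mul fun x y => ?_
  by_cases hx : x ∈ exterior D <;> by_cases hy : y ∈ exterior D
  · simpa [hx, hy] using hF.dist_le_mul x y
  · simpa [hx, hy, Real.dist_eq] using key x hx y hy
  · rw [dist_comm x y]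
    simpa [hx, hy, Real.dist_eq] using key y hy x hx
  · simp only [hx, hy, not_false_eq_true, indicator_of_notMem, dist_self]
    positivity

/-- A compactly supported function whose support misses `∂D` splits into a part inside `D` and a
part with compact support in the exterior. -/
lemma tsupport_indicator_exterior (hD : IsOpen D) {F : E n → ℝ} (hc : HasCompactSupport F)
    (hbd : ∀ x ∈ frontier D, x ∉ tsupport F) :
    HasCompactSupport ((exterior D).indicator F) ∧
      tsupport ((exterior D).indicator F) ⊆ tsupport F \ closure D := by
  have hcl : IsClosed (tsupport F \ D) := (isClosed_tsupport F).sdiff hD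
  have hsub : tsupport ((exterior D).indicator F) ⊆ tsupport F \ D := by
    refine closure_minimal (fun x hx => ?_) hcl
    have hxe : x ∈ exterior D := by
      by_contra h
      exact hx (indicator_of_notMem h F)
    have hxF : F x ≠ 0 := by
      intro h
      exact hx (by simp [hxe, h])
    exact ⟨subset_tsupport F hxF, fun h => hxe (subset_closure h)⟩
  refine ⟨hc.isCompact.of_isClosed_subset (isClosed_tsupport _) (hsub.trans sdiff_subset), ?_⟩
  intro x hx
  obtain ⟨h1, h2⟩ := hsub hx
  refine ⟨h1, fun h => hbd x ?_ h1⟩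
  rw [hD.frontier_eq]
  exact ⟨h, h2⟩

lemma gradient_indicator_exterior (F : E n → ℝ) {x : E n} (hx : x ∈ exterior D) :
    ∇ ((exterior D).indicator F) x = ∇ F x := by
  refine Filter.EventuallyEq.gradient_eq ?_
  filter_upwards [(isOpen_exterior D).mem_nhds hx] with y hy
  simp [hy]

/-- A field that is orthogonal to all test functions in `Ω \ closure D` is orthogonal on the
exterior to all Lipschitz functions with compact support in `Ω` that vanish near `∂D`. -/
lemma setIntegral_exterior_eq_zero (hD : IsOpen D) (hΩ : IsOpen Ω) {Y : E n → E n}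
    (hY : ∀ S, IsCompact S → IntegrableOn Y S (volume.restrict (exterior D)))
    (h : ∀ ψ, IsTest (Ω \ closure D) ψ → ∫ x in exterior D, inner ℝ (Y x) (∇ ψ x) = 0)
    {F : E n → ℝ} {K : ℝ≥0} (hF : LipschitzWith K F) (hc : HasCompactSupport F)
    (hsub : tsupport F ⊆ Ω) (hbd : ∀ x ∈ frontier D, x ∉ tsupport F) :
    ∫ x in exterior D, inner ℝ (Y x) (∇ F x) = 0 := by
  obtain ⟨h1, h2⟩ := tsupport_indicator_exterior hD hc hbd
  have hL := lipschitzWith_indicator_exterior (D := D) hF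
    fun x hx => image_eq_zero_of_notMem_tsupport (hbd x hx)
  have h3 := integral_inner_gradient_eq_of_lipschitz (hΩ.sdiff isClosed_closure) hY
    (σ := 0) (g := fun _ => 0) (by simp) (fun ψ hψ => by simpa using h ψ hψ) hL h1
    (h2.trans (sdiff_subset_sdiff_left hsub))
  rw [integral_zero_measure] at h3
  rw [← h3]
  refine setIntegral_congr_fun (isOpen_exterior D).measurableSet fun x hx => ?_
  simp only [gradient_indicator_exterior F hx]

end Exterior

/-! ### Support and regularity of outer functions -/

section Outer

variable {h h₁ h₂ : ℝ × ℝ → ℝ} {C : ℝ}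

lemma IsOuter.tsupport_subset (hh : IsOuter h h₁ h₂ C) (ζ U V : E n → ℝ) :
    tsupport (fun x => ζ x * h (U x, V x)) ⊆ tsupport U ∪ tsupport V := by
  refine closure_minimal (fun x hx => ?_) ((isClosed_tsupport U).union (isClosed_tsupport V))
  by_contra hcon
  rw [mem_union, not_or] at hcon
  refine hx ?_
  have h0 : h ((0 : ℝ), (0 : ℝ)) = 0 := hh.zero
  simp [image_eq_zero_of_notMem_tsupport hcon.1, image_eq_zero_of_notMem_tsupport hcon.2, h0]

lemma IsOuter.hasCompactSupport (hh : IsOuter h h₁ h₂ C) (ζ : E n → ℝ) {U V : E n → ℝ}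
    (hU : HasCompactSupport U) (hV : HasCompactSupport V) :
    HasCompactSupport (fun x => ζ x * h (U x, V x)) :=
  (hU.isCompact.union hV.isCompact).of_isClosed_subset (isClosed_tsupport _)
    (hh.tsupport_subset ζ U V)

lemma IsOuter.lipschitz (hh : IsOuter h h₁ h₂ C) {ζ : E n → ℝ} {B : ℝ} (hζ : ContDiff ℝ 1 ζ)
    (hB : ∀ x, |ζ x| ≤ B) (hB' : ∀ x, ‖∇ ζ x‖ ≤ B) {U V : E n → ℝ}
    (hU : HasCompactSupport U) (hV : HasCompactSupport V)
    (hUl : ∃ K : ℝ≥0, LipschitzWith K U) (hVl : ∃ K : ℝ≥0, LipschitzWith K V) :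
    ∃ K : ℝ≥0, LipschitzWith K (fun x => ζ x * h (U x, V x)) := by
  obtain ⟨KU, hKU⟩ := hUl
  obtain ⟨KV, hKV⟩ := hVl
  obtain ⟨Kh, hKh⟩ := hh.lipschitzWith
  have hB0 : 0 ≤ B := (abs_nonneg _).trans (hB 0)
  have hζl : LipschitzWith ⟨B, hB0⟩ ζ := by
    refine lipschitzWith_of_nnnorm_fderiv_le (𝕜 := ℝ) (hζ.differentiable one_ne_zero) fun x => ?_
    have := hB' x
    rw [norm_gradient_eq] at this
    exact this
  have hw : LipschitzWith (Kh * max KU KV) (fun x => h (U x, V x)) :=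
    hKh.comp (hKU.prodMk hKV)
  have hwc : HasCompactSupport (fun x => h (U x, V x)) := by
    simpa using hh.hasCompactSupport (fun _ => 1) hU hV
  obtain ⟨M, hM⟩ := hwc.exists_bound_of_continuous hw.continuous
  have hM0 : 0 ≤ M := (norm_nonneg _).trans (hM 0)
  lift B to ℝ≥0 using hB0
  lift M to ℝ≥0 using hM0
  refine ⟨B * (Kh * max KU KV) + M * B, LipschitzWith.of_dist_le_mul fun x y => ?_⟩
  have h1 := hζl.dist_le_mul x y
  have h2 := hw.dist_le_mul x y
  rw [Real.dist_eq] at h1 h2 ⊢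
  calc |ζ x * h (U x, V x) - ζ y * h (U y, V y)|
      = |ζ x * (h (U x, V x) - h (U y, V y)) + h (U y, V y) * (ζ x - ζ y)| := by ring_nf
    _ ≤ |ζ x| * |h (U x, V x) - h (U y, V y)| + |h (U y, V y)| * |ζ x - ζ y| := by
        rw [← abs_mul, ← abs_mul]; exact abs_add_le _ _
    _ ≤ B * ((Kh * max KU KV : ℝ≥0) * dist x y) + M * (B * dist x y) :=
        add_le_add (mul_le_mul (hB x) h2 (abs_nonneg _) B.coe_nonneg)
          (mul_le_mul (hM y) h1 (abs_nonneg _) M.coe_nonneg)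
    _ = _ := by push_cast; ring

end Outer

/-! ### Approximation of potentials and integration by parts -/

section Approx

variable {D Ω : Set (E n)} {P : ℝ≥0∞} {φ u : E n → ℝ} {G : E n → E n} {U : ℕ → E n → ℝ}

lemma memLp_gradient {F : E n → ℝ} {K : ℝ≥0} (hF : LipschitzWith K F)
    (hc : HasCompactSupport F) {μ : Measure (E n)} [IsFiniteMeasureOnCompacts μ] :
    MemLp (∇ F) P μ := by
  have hc' : HasCompactSupport (∇ F) := by
    refine hc.mono' fun x hx => ?_
    by_contra h
    exact hx (gradient_of_notMem_tsupport h)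
  exact hc'.memLp_of_bound (measurable_gradient F).aestronglyMeasurable K
    (Eventually.of_forall fun x => norm_gradient_le hF x)

lemma integrableOn_of_memLp_of_isCompact {F : Type*} [NormedAddCommGroup F] {μ : Measure (E n)}
    [IsLocallyFiniteMeasure μ] {f : E n → F} (hf : MemLp f P μ) (hP : 1 ≤ P) {S : Set (E n)}
    (hS : IsCompact S) : IntegrableOn f S μ :=
  (hf.locallyIntegrable hP).integrableOn_isCompact hS

/-- Two fields in `L^P` of an open set that have the same pairings with test functions agree. -/
lemma ae_eq_zero_of_forall_test {V : Set (E n)} (hV : IsOpen V) (hP : 1 ≤ P) {f : E n → E n}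
    (hf : MemLp f P (volume.restrict V))
    (h : ∀ ζ, IsTest V ζ → ∀ v : E n, ∫ x in V, ζ x * inner ℝ v (f x) = 0) :
    ∀ᵐ x ∂(volume.restrict V), f x = 0 := by
  have hloc : LocallyIntegrable f (volume.restrict V) := hf.locallyIntegrable hP
  rw [ae_restrict_iff' hV.measurableSet]
  refine hV.ae_eq_zero_of_integral_contDiff_smul_eq_zero
    (locallyIntegrableOn_of_locallyIntegrable_restrict hloc) fun ζ h1 h2 h3 => ?_
  have hint : Integrable (fun x => ζ x • f x) (volume.restrict V) :=
    hloc.integrable_smul_left_of_hasCompactSupport h1.continuous h2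
  have h4 : ∫ x in V, ζ x • f x = ∫ x, ζ x • f x := by
    refine setIntegral_eq_integral_of_forall_compl_eq_zero fun x hx => ?_
    rw [image_eq_zero_of_notMem_tsupport fun hx' => hx (h3 hx'), zero_smul]
  rw [← h4]
  refine ext_inner_left ℝ fun v => ?_
  rw [← integral_inner hint, inner_zero_right, ← h ζ ⟨h1, h2, h3⟩ v]
  simp only [inner_smul_right]

lemma exists_bound_of_isTest {V : Set (E n)} {ζ : E n → ℝ} (hζ : IsTest V ζ) :
    ∃ B : ℝ, (∀ x, |ζ x| ≤ B) ∧ ∀ x, ‖∇ ζ x‖ ≤ B := by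
  obtain ⟨B, hB⟩ := hζ.2.1.exists_bound_of_continuous hζ.1.continuous
  obtain ⟨K, hK⟩ := hζ.1.lipschitzWith_of_hasCompactSupport hζ.2.1 (by simp)
  exact ⟨max B K, fun x => (hB x).trans (le_max_left _ _),
    fun x => (norm_gradient_le hK x).trans (le_max_right _ _)⟩

/-- Integration by parts against `ζ` for an outer function of Sobolev functions, provided that
the approximations vanish near `∂D`. -/
lemma integral_inner_outerGrad_eq_zero (hD : IsOpen D) (hP : 1 ≤ P)
    {h h₁ h₂ : ℝ × ℝ → ℝ} {C : ℝ} (hh : IsOuter h h₁ h₂ C) {ζ : E n → ℝ} (hζ : IsTest univ ζ)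
    {u v : E n → ℝ} {G H : E n → E n} {U V : ℕ → E n → ℝ}
    (hU : GradApprox P (volume.restrict (exterior D)) u G U)
    (hV : GradApprox P (volume.restrict (exterior D)) v H V)
    (hbd : ∀ k, ∀ x ∈ frontier D, x ∉ tsupport (fun x => ζ x * h (U k x, V k x))) (e : E n) :
    ∫ x in exterior D, inner ℝ e (outerGrad h h₁ h₂ ζ u v G H x) = 0 := by
  obtain ⟨B, hB, hB'⟩ := exists_bound_of_isTest hζ
  have hζ1 : ContDiff ℝ 1 ζ := hζ.1.of_le (by exact_mod_cast le_top)
  have : ENNReal.HolderTriple (ENNReal.conjExponent P) P 1 :=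
    (ENNReal.HolderConjugate.conjExponent hP).symm
  -- cutting the constant field off makes it integrable to the conjugate power
  let Y : E n → E n := (tsupport ζ).indicator fun _ => e
  have hY : MemLp Y (ENNReal.conjExponent P) (volume.restrict (exterior D)) :=
    memLp_indicator_const _ (isClosed_tsupport ζ).measurableSet _
      (Or.inr hζ.2.1.isCompact.measure_lt_top.ne)
  obtain ⟨-, h2⟩ := tendsto_integral_inner_gradient_outer
    Measure.restrict_le_self.absolutelyContinuous hY hh hζ1 hB hB' hU hV
  have h3 : ∀ x, inner ℝ e (outerGrad h h₁ h₂ ζ u v G H x) =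
      inner ℝ (Y x) (outerGrad h h₁ h₂ ζ u v G H x) := by
    intro x
    by_cases hx : x ∈ tsupport ζ
    · simp [Y, hx]
    · simp [Y, hx, outerGrad, gradient_of_notMem_tsupport hx, image_eq_zero_of_notMem_tsupport hx]
  simp only [h3]
  refine tendsto_nhds_unique h2 (tendsto_const_nhds.congr fun k => ?_)
  have hsub : tsupport (fun x => ζ x * h (U k x, V k x)) ⊆ tsupport ζ := tsupport_mul_subset_left
  obtain ⟨K, hK⟩ := hh.lipschitz hζ1 hB hB' (hU.compact k) (hV.compact k) (hU.lip k) (hV.lip k)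
  have hc := hh.hasCompactSupport ζ (hU.compact k) (hV.compact k)
  have hL := lipschitzWith_indicator_exterior (D := D) hK
    fun x hx => image_eq_zero_of_notMem_tsupport
      (f := fun x => ζ x * h (U k x, V k x)) (hbd k x hx)
  obtain ⟨hc', hs'⟩ := tsupport_indicator_exterior hD hc (hbd k)
  rw [← integral_inner_gradient_eq_zero hL hc' e,
    ← setIntegral_eq_integral_of_forall_compl_eq_zero (s := exterior D)]
  · refine setIntegral_congr_fun (isOpen_exterior D).measurableSet fun x hx => ?_
    simp only [gradient_indicator_exterior _ hx]
    by_cases hx' : x ∈ tsupport ζ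
    · simp [Y, hx']
    · simp [gradient_of_notMem_tsupport fun h' => hx' (hsub h')]
  · intro x hx
    rw [gradient_of_notMem_tsupport fun h' => hx (hs' h').2, inner_zero_right]

lemma isOuter_fst : IsOuter Prod.fst (fun _ => 1) (fun _ => 0) 1 where
  zero := rfl
  hasFDerivAt q := by simpa using hasFDerivAt_fst
  continuous₁ := continuous_const
  continuous₂ := continuous_const
  bound₁ _ := by simp
  bound₂ _ := by simp

/-- The approximations of a potential: Lipschitz functions with compact support in `Ω` and the
prescribed values on `∂D`. -/
structure IsApprox (D Ω : Set (E n)) (P : ℝ≥0∞) (φ u : E n → ℝ) (G : E n → E n)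
    (U : ℕ → E n → ℝ) : Prop extends GradApprox P (volume.restrict (exterior D)) u G U where
  tsupport_subset : ∀ k, tsupport (U k) ⊆ Ω
  boundary : ∀ k, ∀ x ∈ frontier D, U k x = φ x

lemma GradApprox.congr {μ : Measure (E n)} {u' : E n → ℝ} {G' : E n → E n}
    (hU : GradApprox P μ u G U) (hu : u =ᵐ[μ] u') (hG : G =ᵐ[μ] G') :
    GradApprox P μ u' G' U where
  lip := hU.lip
  compact := hU.compact
  memLp := (memLp_congr_ae hu).1 hU.memLp
  memLp_grad := (memLp_congr_ae hG).1 hU.memLp_grad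
  memLp_approx := hU.memLp_approx
  memLp_grad_approx := hU.memLp_grad_approx
  tendsto := hU.tendsto.congr fun k => eLpNorm_congr_ae <| by
    filter_upwards [hu] with x hx; rw [hx]
  tendsto_grad := hU.tendsto_grad.congr fun k => eLpNorm_congr_ae <| by
    filter_upwards [hG] with x hx; rw [hx]
  ae_tendsto := by filter_upwards [hU.ae_tendsto, hu] with x h1 h2; rwa [← h2]

/-- The potential of `Ω` is approximated on the whole exterior. The point is that its gradient
vanishes almost everywhere outside `Ω`, even if `∂Ω` has positive measure. -/
lemma IsPotential.exists_isApprox {p : ℝ} (hp : 1 < p) {A : E n → E n → E n} (hD : IsOpen D)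
    (hΩ : IsConfiguration D Ω) (hu : IsPotential D p A φ Ω u G) :
    ∃ U, IsApprox D Ω (ENNReal.ofReal p) φ u G U := by
  have hP : (1 : ℝ≥0∞) ≤ ENNReal.ofReal p := by
    rw [← ENNReal.ofReal_one]; exact ENNReal.ofReal_le_ofReal hp.le
  have hP0 : ENNReal.ofReal p ≠ 0 := (zero_lt_one.trans_le hP).ne'
  obtain ⟨Φ, ⟨KΦ, hΦl⟩, hΦc, hΦs, hΦb, ψ, hψ, hψ1, hψ2⟩ := hu.boundary
  have hψl : ∀ k, ∃ K : ℝ≥0, LipschitzWith K (ψ k) := fun k =>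
    (hψ k).1.lipschitzWith_of_hasCompactSupport (hψ k).2.1 (by simp)
  set P := ENNReal.ofReal p with hPdef
  let μ : Measure (E n) := volume.restrict (exterior D)
  have hμ : μ ≪ volume := Measure.restrict_le_self.absolutelyContinuous
  have hres : μ.restrict Ω = volume.restrict (Ω \ closure D) := by
    rw [Measure.restrict_restrict hΩ.isOpen.measurableSet]; rfl
  let U : ℕ → E n → ℝ := fun k x => Φ x + ψ k x
  have hUl : ∀ k, ∃ K : ℝ≥0, LipschitzWith K (U k) := fun k => by
    obtain ⟨K, hK⟩ := hψl k
    exact ⟨_, hΦl.add hK⟩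
  have hUc : ∀ k, HasCompactSupport (U k) := fun k => hΦc.add (hψ k).2.1
  have hUs : ∀ k, tsupport (U k) ⊆ Ω := fun k =>
    (tsupport_add Φ (ψ k)).trans (union_subset hΦs ((hψ k).2.2.trans sdiff_subset))
  have hUcont : ∀ k, Continuous (U k) := fun k => (hUl k).choose_spec.continuous
  have hUm : ∀ k, MemLp (U k) P μ := fun k => (hUcont k).memLp_of_hasCompactSupport (hUc k)
  have hUgm : ∀ k, MemLp (∇ (U k)) P μ := fun k => memLp_gradient (hUl k).choose_spec (hUc k)
  have hum : MemLp (Ω.indicator u) P μ := hu.memSobolev.memLp.indicator hΩ.isOpen.measurableSet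
  have hGm : MemLp (Ω.indicator G) P μ :=
    hu.memSobolev.memLp_grad.indicator hΩ.isOpen.measurableSet
  have hgrad : ∀ k, ∀ᵐ x ∂μ, ∇ (U k) x = ∇ Φ x + ∇ (ψ k) x := by
    intro k
    filter_upwards [hμ.ae_le (hΦl.ae_differentiableAt (μ := (volume : Measure (E n))))] with x hx
    have h1 : DifferentiableAt ℝ (ψ k) x := (hψ k).1.differentiable (by simp) x
    refine ext_inner_right ℝ fun v => ?_
    rw [inner_gradient_eq, inner_add_left, inner_gradient_eq, inner_gradient_eq]
    have : fderiv ℝ (U k) x = fderiv ℝ Φ x + fderiv ℝ (ψ k) x := fderiv_add hx h1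
    rw [this]
    rfl
  have hlim : Tendsto (fun k => eLpNorm (fun x => U k x - Ω.indicator u x) P μ) atTop (𝓝 0) := by
    refine hψ1.congr fun k => ?_
    rw [← hres, ← eLpNorm_indicator_eq_eLpNorm_restrict hΩ.isOpen.measurableSet, ← eLpNorm_neg]
    congr 1
    ext x
    by_cases hx : x ∈ Ω
    · simp [hx, U]; ring
    · simp [hx, image_eq_zero_of_notMem_tsupport fun h => hx (hUs k h)]
  have hlimg : Tendsto (fun k => eLpNorm (fun x => ∇ (U k) x - Ω.indicator G x) P μ) atTop
      (𝓝 0) := by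
    refine hψ2.congr fun k => ?_
    rw [← hres, ← eLpNorm_indicator_eq_eLpNorm_restrict hΩ.isOpen.measurableSet, ← eLpNorm_neg]
    refine eLpNorm_congr_ae ?_
    filter_upwards [hgrad k] with x hgx
    by_cases hx : x ∈ Ω
    · simp [hx, hgx]; abel
    · simp [hx, gradient_of_notMem_tsupport fun h => hx (hUs k h)]
  -- the approximations converge to the parts of `u` and `G` in `Ω`
  obtain ⟨ns, hns, hae⟩ := (tendstoInMeasure_of_tendsto_eLpNorm hP0
    (fun k => (hUm k).aestronglyMeasurable) hum.aestronglyMeasurable hlim).exists_seq_tendsto_ae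
  have hA : GradApprox P μ (Ω.indicator u) (Ω.indicator G) (fun k => U (ns k)) :=
    { lip := fun k => hUl _
      compact := fun k => hUc _
      memLp := hum
      memLp_grad := hGm
      memLp_approx := fun k => hUm _
      memLp_grad_approx := fun k => hUgm _
      tendsto := hlim.comp hns.tendsto_atTop
      tendsto_grad := hlimg.comp hns.tendsto_atTop
      ae_tendsto := hae }
  have huae : Ω.indicator u =ᵐ[μ] u := by
    filter_upwards [hμ.ae_le hu.zero_outside] with x hx
    by_cases h : x ∈ Ω
    · simp [h]
    · simp [h, hx h]
  -- both fields are weak gradients of `u`, hence they agree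
  have hGae : Ω.indicator G =ᵐ[μ] G := by
    have h0 : ∀ᵐ x ∂μ, (Ω.indicator G - G) x = 0 := by
      refine ae_eq_zero_of_forall_test (isOpen_exterior D) hP (hGm.sub hu.memSobolev.memLp_grad)
        fun ζ hζ v => ?_
      have h1 := integral_inner_outerGrad_eq_zero hD hP isOuter_fst
        (ζ := ζ) ⟨hζ.1, hζ.2.1, subset_univ _⟩ hA hA
        (fun k x hx h => (hζ.2.2 (tsupport_mul_subset_left h)) (frontier_subset_closure hx)) v
      have h2 := hu.memSobolev.weakGrad ζ hζ v
      have hi : ∀ {f : E n → E n}, MemLp f P μ →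
          Integrable (fun x => ζ x * inner ℝ v (f x)) μ := by
        intro f hf
        have := (hf.locallyIntegrable hP).integrable_smul_left_of_hasCompactSupport
          hζ.1.continuous hζ.2.1
        simpa [inner_smul_right] using Integrable.const_inner (𝕜 := ℝ) v this
      have hi' : Integrable (fun x => u x * inner ℝ (∇ ζ x) v) μ := by
        have hζc : Continuous (∇ ζ) :=
          continuous_gradient (hζ.1.of_le (by exact_mod_cast le_top))
        have hc' : HasCompactSupport (fun x => inner ℝ (∇ ζ x) v) := by
          refine hζ.2.1.mono' fun x hx => ?_
          by_contra h
          exact hx (by simp [gradient_of_notMem_tsupport h])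
        have := (hu.memSobolev.memLp.locallyIntegrable hP).integrable_smul_left_of_hasCompactSupport
          (hζc.inner continuous_const) hc'
        simpa [mul_comm] using this
      have h3 : ∫ x in exterior D, inner ℝ v (outerGrad Prod.fst (fun _ => 1) (fun _ => 0) ζ
          (Ω.indicator u) (Ω.indicator u) (Ω.indicator G) (Ω.indicator G) x) =
          (∫ x in exterior D, u x * inner ℝ (∇ ζ x) v) +
            ∫ x in exterior D, ζ x * inner ℝ v (Ω.indicator G x) := by
        rw [← integral_add hi' (hi hGm)]
        refine integral_congr_ae ?_
        filter_upwards [huae] with x hx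
        simp [outerGrad, hx, inner_add_right, inner_smul_right]
      rw [h1, h2] at h3
      have h4 : ∫ x in exterior D, ζ x * inner ℝ v ((Ω.indicator G - G) x) =
          (∫ x in exterior D, ζ x * inner ℝ v (Ω.indicator G x)) -
            ∫ x in exterior D, ζ x * inner ℝ v (G x) := by
        rw [← integral_sub (hi hGm) (hi hu.memSobolev.memLp_grad)]
        refine integral_congr_ae (Eventually.of_forall fun x => ?_)
        simp only [Pi.sub_apply, inner_sub_right]
        ring
      have h5 : ∫ x in exterior D, ζ x * inner ℝ v (G x) =
          ∫ x in exterior D, inner ℝ (G x) v * ζ x := by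
        refine integral_congr_ae (Eventually.of_forall fun x => ?_)
        simp only [real_inner_comm, mul_comm]
      rw [h4, h5]
      linarith
    filter_upwards [h0] with x hx
    exact sub_eq_zero.1 hx
  refine ⟨_, { hA.congr huae hGae with tsupport_subset := fun k => hUs _, boundary := ?_ }⟩
  intro k x hx
  have : x ∉ tsupport (ψ (ns k)) := fun h => ((hψ _).2.2 h).2 (frontier_subset_closure hx)
  simp [U, hΦb x hx, image_eq_zero_of_notMem_tsupport this]

end Approx

/-! ### Integrability of the flux -/

section Flux

variable {D : Set (E n)} {p : ℝ} {A : E n → E n → E n}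

/-- A Carathéodory field composed with a measurable field is measurable. -/
lemma IsDegenerateElliptic.aestronglyMeasurable_comp (hA : IsDegenerateElliptic D p A)
    {G : E n → E n} (hG : AEStronglyMeasurable G (volume.restrict (exterior D))) :
    AEStronglyMeasurable (fun x => A x (G x)) (volume.restrict (exterior D)) := by
  let s := hG.stronglyMeasurable_mk.approx
  have hs : ∀ k, AEMeasurable (fun x => A x (s k x)) (volume.restrict (exterior D)) := by
    intro k
    have h1 : (fun x => A x (s k x)) =
        fun x => ∑ ξ ∈ (s k).range, ((s k) ⁻¹' {ξ}).indicator (fun x => A x ξ) x := by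
      ext1 x
      rw [Finset.sum_eq_single (s k x)]
      · simp
      · intro ξ _ hne
        exact indicator_of_notMem (fun h => hne (by simpa using h.symm)) _
      · intro h
        exact absurd ((s k).mem_range_self x) h
    rw [h1]
    exact Finset.aemeasurable_fun_sum _ fun ξ _ =>
      (hA.measurable ξ).indicator ((s k).measurableSet_fiber ξ)
  refine (aemeasurable_of_tendsto_metrizable_ae atTop hs ?_).aestronglyMeasurable
  filter_upwards [hA.continuous, hG.ae_eq_mk] with x h1 h2
  rw [h2]
  exact (h1.tendsto _).comp (hG.stronglyMeasurable_mk.tendsto_approx x)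

lemma IsDegenerateElliptic.memLp_comp (hp : 1 < p) (hA : IsDegenerateElliptic D p A)
    {G : E n → E n} (hG : MemLp G (ENNReal.ofReal p) (volume.restrict (exterior D))) :
    MemLp (fun x => A x (G x)) (ENNReal.ofReal p.conjExponent)
      (volume.restrict (exterior D)) := by
  obtain ⟨l, L, hl, hlL, h⟩ := hA.elliptic
  have hp1 : 0 < p - 1 := by linarith
  have h1 := hG.norm_rpow_div (ENNReal.ofReal (p - 1))
  rw [ENNReal.toReal_ofReal hp1.le, ← ENNReal.ofReal_div_of_pos hp1] at h1
  refine (h1.const_mul L).mono (hA.aestronglyMeasurable_comp hG.aestronglyMeasurable) ?_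
  filter_upwards [h] with x hx
  exact (hx (G x)).2.trans (le_abs_self _)

lemma holderTriple_conjExponent (hp : 1 < p) :
    ENNReal.HolderTriple (ENNReal.ofReal p.conjExponent) (ENNReal.ofReal p) 1 :=
  (Real.HolderConjugate.conjExponent hp).symm.ennrealOfReal

lemma one_le_ofReal (hp : 1 < p) : (1 : ℝ≥0∞) ≤ ENNReal.ofReal p := by
  rw [← ENNReal.ofReal_one]; exact ENNReal.ofReal_le_ofReal hp.le

lemma one_le_conjExponent (hp : 1 < p) : (1 : ℝ≥0∞) ≤ ENNReal.ofReal p.conjExponent :=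
  one_le_ofReal (Real.HolderConjugate.conjExponent hp).symm.lt

end Flux

/-! ### Test functions built from the potentials, and functions without gradient -/

section Testing

variable {D Ω : Set (E n)} {P Q : ℝ≥0∞} {h h₁ h₂ : ℝ × ℝ → ℝ} {C : ℝ}

/-- The equation in `Ω \ closure D` may be tested with `ζ h(u, v)` as soon as the approximations
`ζ h(U k, V k)` are supported in `Ω` and vanish near `∂D`. -/
lemma integral_inner_outerGrad_eq_zero_of_equation [Q.HolderTriple P 1] (hQ : 1 ≤ Q)
    (hD : IsOpen D) (hΩ : IsOpen Ω) {Y : E n → E n}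
    (hY : MemLp Y Q (volume.restrict (exterior D)))
    (heq : ∀ ψ, IsTest (Ω \ closure D) ψ → ∫ x in exterior D, inner ℝ (Y x) (∇ ψ x) = 0)
    (hh : IsOuter h h₁ h₂ C) {ζ : E n → ℝ} {B : ℝ} (hζ : ContDiff ℝ 1 ζ)
    (hB : ∀ x, |ζ x| ≤ B) (hB' : ∀ x, ‖∇ ζ x‖ ≤ B)
    {u v : E n → ℝ} {G H : E n → E n} {U V : ℕ → E n → ℝ}
    (hU : GradApprox P (volume.restrict (exterior D)) u G U)
    (hV : GradApprox P (volume.restrict (exterior D)) v H V)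
    (hsub : ∀ k, tsupport (fun x => ζ x * h (U k x, V k x)) ⊆ Ω)
    (hbd : ∀ k, ∀ x ∈ frontier D, x ∉ tsupport (fun x => ζ x * h (U k x, V k x))) :
    Integrable (fun x => inner ℝ (Y x) (outerGrad h h₁ h₂ ζ u v G H x))
      (volume.restrict (exterior D)) ∧
    ∫ x in exterior D, inner ℝ (Y x) (outerGrad h h₁ h₂ ζ u v G H x) = 0 := by
  obtain ⟨h1, h2⟩ := tendsto_integral_inner_gradient_outer
    Measure.restrict_le_self.absolutelyContinuous hY hh hζ hB hB' hU hV
  refine ⟨h1, tendsto_nhds_unique h2 (tendsto_const_nhds.congr fun k => ?_)⟩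
  obtain ⟨K, hK⟩ := hh.lipschitz hζ hB hB' (hU.compact k) (hV.compact k) (hU.lip k) (hV.lip k)
  exact (setIntegral_exterior_eq_zero hD hΩ
    (fun S hS => integrableOn_of_memLp_of_isCompact hY hQ hS) heq hK
    (hh.hasCompactSupport ζ (hU.compact k) (hV.compact k)) (hsub k) (hbd k)).symm

/-- An integrable function on `ℝⁿ`, `n ≥ 1`, with zero weak gradient vanishes: its mollifications
are constant and integrable. -/
lemma ae_eq_zero_of_weak_gradient_eq_zero (hn : 1 ≤ n) {f : E n → ℝ} (hf : Integrable f)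
    (h : ∀ ζ, IsTest univ ζ → ∀ e : E n, ∫ x, f x * inner ℝ e (∇ ζ x) = 0) :
    f =ᵐ[volume] 0 := by
  have : Nonempty (Fin n) := ⟨⟨0, hn⟩⟩
  have key : ∀ κ : E n → ℝ, IsTest univ κ → ∀ x, ∫ y, f y * κ (x - y) = 0 := by
    intro κ hκ
    have hκ1 : ContDiff ℝ 1 κ := hκ.1.of_le (by exact_mod_cast le_top)
    let c := convolution f κ (ContinuousLinearMap.lsmul ℝ ℝ) volume
    have hder : ∀ x, HasFDerivAt c _ x := fun x =>
      hκ.2.1.hasFDerivAt_convolution_right (ContinuousLinearMap.lsmul ℝ ℝ)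
        hf.locallyIntegrable hκ1 x
    have hzero : ∀ x, fderiv ℝ c x = 0 := by
      intro x
      rw [(hder x).fderiv]
      ext e
      rw [convolution_precompR_apply (ContinuousLinearMap.lsmul ℝ ℝ) hf.locallyIntegrable
        (hκ.2.1.fderiv ℝ) (hκ1.continuous_fderiv one_ne_zero)]
      let ζ : E n → ℝ := fun y => κ (x - y)
      have hζ : IsTest univ ζ :=
        ⟨hκ.1.comp (contDiff_const.sub contDiff_id),
          hκ.2.1.comp_homeomorph (Homeomorph.subLeft x), subset_univ _⟩
      have h1 := h ζ hζ e
      have h2 : ∀ y, inner ℝ e (∇ ζ y) = -(fderiv ℝ κ (x - y) e) := by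
        intro y
        rw [real_inner_comm, inner_gradient_eq]
        have h3 : HasFDerivAt κ (fderiv ℝ κ (x - y)) (x - y) :=
          (hκ1.differentiable one_ne_zero _).hasFDerivAt
        have h4 := (h3.comp y ((hasFDerivAt_id y).const_sub x)).fderiv
        have h5 : fderiv ℝ ζ y = _ := h4
        rw [h5]
        simp
      simp only [h2, mul_neg, integral_neg, neg_eq_zero] at h1
      simpa [convolution] using h1
    have hconst : ∀ x y, c x = c y :=
      is_const_of_fderiv_eq_zero (fun x => (hder x).differentiableAt) hzero
    have hci : Integrable c := hf.integrable_convolution _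
      (hκ.1.continuous.integrable_of_hasCompactSupport hκ.2.1)
    have hc0 : c = fun _ => c 0 := funext fun x => hconst x 0
    rw [hc0, integrable_const_iff] at hci
    have hc00 : c 0 = 0 := by
      rcases hci with h0 | h0
      · exact h0
      · exact absurd h0.1 (by simp)
    intro x
    have := (hconst x 0).trans hc00
    simpa [c, convolution] using this
  refine ae_eq_zero_of_integral_contDiff_smul_eq_zero hf.locallyIntegrable fun g hg hgc => ?_
  have := key (fun y => g (-y)) ⟨hg.comp contDiff_neg,
    hgc.comp_homeomorph (Homeomorph.neg (E n)), subset_univ _⟩ 0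
  simpa [mul_comm] using this

/-- If an outer function of Sobolev functions that vanish outside `Ω` has zero gradient and
vanishes near `∂D`, then it is zero. -/
lemma outer_ae_eq_zero (hn : 1 ≤ n) (hP : 1 ≤ P) (hD : IsOpen D) (hΩ : IsConfiguration D Ω)
    (hh : IsOuter h h₁ h₂ C) {M : ℝ} (hM : ∀ q, |h q| ≤ M)
    {u v : E n → ℝ} {G H : E n → E n} {U V : ℕ → E n → ℝ}
    (hU : GradApprox P (volume.restrict (exterior D)) u G U)
    (hV : GradApprox P (volume.restrict (exterior D)) v H V)
    (hu : ∀ᵐ x, x ∉ Ω → u x = 0) (hv : ∀ᵐ x, x ∉ Ω → v x = 0)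
    (hbd : ∀ k, ∀ x ∈ frontier D, x ∉ tsupport (fun x => h (U k x, V k x)))
    (hgrad : ∀ᵐ x ∂(volume.restrict (exterior D)),
      h₁ (u x, v x) • G x + h₂ (u x, v x) • H x = 0) :
    ∀ᵐ x ∂(volume.restrict (exterior D)), h (u x, v x) = 0 := by
  have hext : MeasurableSet (exterior D) := (isOpen_exterior D).measurableSet
  let w : E n → ℝ := (exterior D).indicator fun x => h (u x, v x)
  have hwm : AEStronglyMeasurable w volume := by
    refine (aestronglyMeasurable_indicator_iff hext).2 ?_
    exact hh.continuous.comp_aestronglyMeasurable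
      (hU.memLp.aestronglyMeasurable.prodMk hV.memLp.aestronglyMeasurable)
  have hw : Integrable w := by
    have hfin : Integrable ((Ω \ D).indicator fun _ => M) := by
      rw [integrable_indicator_iff (hΩ.isOpen.measurableSet.diff hD.measurableSet)]
      exact integrableOn_const hΩ.volume_lt_top.ne
    refine hfin.mono hwm ?_
    filter_upwards [hu, hv] with x h1 h2
    by_cases hx : x ∈ exterior D
    · by_cases hxΩ : x ∈ Ω
      · have hxD : x ∉ D := fun h => hx (subset_closure h)
        simpa [w, hx, hxΩ, hxD] using (hM (u x, v x)).trans (le_abs_self M)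
      · have h0 : h ((0 : ℝ), (0 : ℝ)) = 0 := hh.zero
        simp [w, hx, h1 hxΩ, h2 hxΩ, h0]
    · simp [w, hx]
  have hz := ae_eq_zero_of_weak_gradient_eq_zero hn hw fun ζ hζ e => ?_
  · rw [ae_restrict_iff' hext]
    filter_upwards [hz] with x hx hxe
    simpa [w, hxe] using hx
  · have h1 := integral_inner_outerGrad_eq_zero hD hP hh hζ hU hV
      (fun k x hx hx' => hbd k x hx (tsupport_mul_subset_right hx')) e
    rw [← h1, ← setIntegral_eq_integral_of_forall_compl_eq_zero (s := exterior D)]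
    · refine integral_congr_ae ?_
      filter_upwards [hgrad, ae_restrict_mem hext] with x hx hxe
      have h2 : outerGrad h h₁ h₂ ζ u v G H x = h (u x, v x) • ∇ ζ x +
          ζ x • (h₁ (u x, v x) • G x + h₂ (u x, v x) • H x) := by
        rw [outerGrad, smul_add, smul_smul, smul_smul]
      simp only [h2, hx, smul_zero, add_zero, w, hxe, indicator_of_mem, inner_smul_right]
    · intro x hx
      simp [w, hx]

end Testing

/-! ### Smooth steps -/

section Step

/-- A smooth nondecreasing step: `0` up to `1 / (j + 1)` and `1` from `2 / (j + 1)` on. -/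
noncomputable def step (j : ℕ) (s : ℝ) : ℝ := Real.smoothTransition ((j + 1) * s - 1)

lemma contDiff_step (j : ℕ) : ContDiff ℝ 1 (step j) :=
  Real.smoothTransition.contDiff.comp ((contDiff_const.mul contDiff_id).sub contDiff_const)

lemma step_nonneg (j : ℕ) (s : ℝ) : 0 ≤ step j s := Real.smoothTransition.nonneg _

lemma step_le_one (j : ℕ) (s : ℝ) : step j s ≤ 1 := Real.smoothTransition.le_one _

lemma step_eq_zero {j : ℕ} {s : ℝ} (hs : (j + 1) * s ≤ 1) : step j s = 0 :=
  Real.smoothTransition.zero_of_nonpos (by linarith)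

lemma step_eq_zero_of_nonpos {j : ℕ} {s : ℝ} (hs : s ≤ 0) : step j s = 0 := by
  refine step_eq_zero ((mul_nonpos_of_nonneg_of_nonpos (by positivity) hs).trans zero_le_one)

lemma step_eq_one {j : ℕ} {s : ℝ} (hs : 2 ≤ (j + 1) * s) : step j s = 1 :=
  Real.smoothTransition.one_of_one_le (by linarith)

lemma monotone_step (j : ℕ) : Monotone (step j) := fun s t hst =>
  Real.smoothTransition.monotone (by
    have : (j + 1 : ℝ) * s ≤ (j + 1) * t := mul_le_mul_of_nonneg_left hst (by positivity)
    linarith)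

lemma deriv_step_nonneg (j : ℕ) (s : ℝ) : 0 ≤ deriv (step j) s := (monotone_step j).deriv_nonneg

lemma hasDerivAt_step (j : ℕ) (s : ℝ) : HasDerivAt (step j) (deriv (step j) s) s :=
  ((contDiff_step j).differentiable one_ne_zero s).hasDerivAt

lemma eventually_step_eq_zero {j : ℕ} {s : ℝ} (hs : (j + 1) * s < 1) : step j =ᶠ[𝓝 s] 0 := by
  have : ∀ᶠ t in 𝓝 s, (j + 1 : ℝ) * t < 1 :=
    (continuous_const.mul continuous_id).continuousAt.eventually_lt continuousAt_const hs
  filter_upwards [this] with t ht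
  exact step_eq_zero ht.le

lemma deriv_step_eq_zero {j : ℕ} {s : ℝ} (hs : (j + 1) * s < 1 ∨ 2 < (j + 1) * s) :
    deriv (step j) s = 0 := by
  rcases hs with hs | hs
  · rw [(eventually_step_eq_zero hs).deriv_eq]
    simp
  · have h1 : ∀ᶠ t in 𝓝 s, 2 < (j + 1 : ℝ) * t :=
      continuousAt_const.eventually_lt (continuous_const.mul continuous_id).continuousAt hs
    have h2 : step j =ᶠ[𝓝 s] fun _ => 1 := by
      filter_upwards [h1] with t ht
      exact step_eq_one ht.le
    rw [h2.deriv_eq]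
    simp

lemma exists_bound_deriv_step (j : ℕ) : ∃ C, ∀ s, |deriv (step j) s| ≤ C := by
  have hc : Continuous (deriv (step j)) := (contDiff_step j).continuous_deriv_one
  obtain ⟨C, hC⟩ := (isCompact_Icc (a := (0 : ℝ)) (b := 2)).exists_bound_of_continuousOn
    hc.continuousOn
  refine ⟨C, fun s => ?_⟩
  by_cases hs : s ∈ Icc (0 : ℝ) 2
  · exact hC s hs
  · rw [deriv_step_eq_zero, abs_zero]
    · exact (norm_nonneg _).trans (hC 0 (by simp))
    · by_cases h0 : 0 ≤ s
      · right
        have h2 : 2 < s := by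
          by_contra h
          exact hs ⟨h0, not_lt.1 h⟩
        nlinarith [j.cast_nonneg (α := ℝ)]
      · left
        nlinarith [j.cast_nonneg (α := ℝ)]

lemma tendsto_step {s : ℝ} (hs : 0 < s) : Tendsto (fun j => step j s) atTop (𝓝 1) := by
  refine tendsto_const_nhds.congr' ?_
  have h1 : Tendsto (fun j : ℕ => ((j : ℝ) + 1) * s) atTop atTop :=
    (tendsto_natCast_atTop_atTop.atTop_add tendsto_const_nhds).atTop_mul_const hs
  filter_upwards [h1.eventually_ge_atTop 2] with j hj
  exact (step_eq_one hj).symm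

lemma exists_step_eq_one {s : ℝ} (hs : 0 < s) : ∃ j, step j s = 1 := by
  obtain ⟨j, hj⟩ := exists_nat_ge (2 / s)
  refine ⟨j, step_eq_one ?_⟩
  rw [div_le_iff₀ hs] at hj
  linarith

lemma isOuter_comp_fst {f f' : ℝ → ℝ} {C : ℝ} (h0 : f 0 = 0) (hf : ∀ s, HasDerivAt f (f' s) s)
    (hc : Continuous f') (hC : ∀ s, |f' s| ≤ C) :
    IsOuter (fun q => f q.1) (fun q => f' q.1) (fun _ => 0) C where
  zero := h0
  hasFDerivAt q := by
    have := (hf q.1).comp_hasFDerivAt q (hasFDerivAt_fst (𝕜 := ℝ) (p := q))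
    rw [zero_smul, add_zero]
    exact this
  continuous₁ := hc.comp continuous_fst
  continuous₂ := continuous_const
  bound₁ q := hC q.1
  bound₂ _ := by simpa using (abs_nonneg _).trans (hC 0)

lemma isOuter_comp_sub {f f' : ℝ → ℝ} {C : ℝ} (h0 : f 0 = 0) (hf : ∀ s, HasDerivAt f (f' s) s)
    (hc : Continuous f') (hC : ∀ s, |f' s| ≤ C) :
    IsOuter (fun q => f (q.1 - q.2)) (fun q => f' (q.1 - q.2)) (fun q => -f' (q.1 - q.2)) C where
  zero := by simp [h0]
  hasFDerivAt q := by
    have := (hf (q.1 - q.2)).comp_hasFDerivAt q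
      ((hasFDerivAt_fst (𝕜 := ℝ) (p := q)).sub (hasFDerivAt_snd (𝕜 := ℝ) (p := q)))
    refine HasFDerivAt.congr_fderiv this ?_
    ext <;> simp
  continuous₁ := hc.comp (continuous_fst.sub continuous_snd)
  continuous₂ := (hc.comp (continuous_fst.sub continuous_snd)).neg
  bound₁ q := hC _
  bound₂ q := by rw [abs_neg]; exact hC _

lemma IsOuter.mul {h h₁ h₂ k k₁ k₂ : ℝ × ℝ → ℝ} {C C' : ℝ} (hh : IsOuter h h₁ h₂ C)
    (hk : IsOuter k k₁ k₂ C') (hh1 : ∀ q, |h q| ≤ 1) (hk1 : ∀ q, |k q| ≤ 1) :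
    IsOuter (fun q => h q * k q) (fun q => h q * k₁ q + k q * h₁ q)
      (fun q => h q * k₂ q + k q * h₂ q) (C' + C) where
  zero := by simp [hh.zero]
  hasFDerivAt q := by
    have := (hh.hasFDerivAt q).mul (hk.hasFDerivAt q)
    refine this.congr_fderiv ?_
    ext <;> simp
  continuous₁ := (hh.continuous.mul hk.continuous₁).add (hk.continuous.mul hh.continuous₁)
  continuous₂ := (hh.continuous.mul hk.continuous₂).add (hk.continuous.mul hh.continuous₂)
  bound₁ q := by
    refine (abs_add_le _ _).trans (add_le_add ?_ ?_) <;> rw [abs_mul]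
    · simpa using mul_le_mul (hh1 q) (hk.bound₁ q) (abs_nonneg _) zero_le_one
    · simpa using mul_le_mul (hk1 q) (hh.bound₁ q) (abs_nonneg _) zero_le_one
  bound₂ q := by
    refine (abs_add_le _ _).trans (add_le_add ?_ ?_) <;> rw [abs_mul]
    · simpa using mul_le_mul (hh1 q) (hk.bound₂ q) (abs_nonneg _) zero_le_one
    · simpa using mul_le_mul (hk1 q) (hh.bound₂ q) (abs_nonneg _) zero_le_one

end Step

/-! ### Gradients on coincidence sets -/

section LevelSet

variable {D : Set (E n)} {P : ℝ≥0∞} {u v : E n → ℝ} {G H : E n → E n} {U V : ℕ → E n → ℝ}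

lemma hasDerivAt_arctan_div (k : ℕ) (s : ℝ) :
    HasDerivAt (fun s => Real.arctan ((k + 1) * s) / (k + 1)) (1 / (1 + ((k + 1) * s) ^ 2)) s := by
  have h1 := ((hasDerivAt_id s).const_mul ((k : ℝ) + 1)).arctan.div_const ((k : ℝ) + 1)
  refine h1.congr_deriv ?_
  have : (k : ℝ) + 1 ≠ 0 := by positivity
  have h2 : 1 + (((k : ℝ) + 1) * s) ^ 2 ≠ 0 := by positivity
  simp only [id]
  field_simp

/-- Two Sobolev functions have the same gradient almost everywhere on the set where they agree.
The gradient of `ε arctan ((u - v) / ε)` tends to `∇u - ∇v` on that set and to `0` off it. -/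
lemma ae_grad_eq_of_eq (hD : IsOpen D) (hP : 1 ≤ P)
    (hU : GradApprox P (volume.restrict (exterior D)) u G U)
    (hV : GradApprox P (volume.restrict (exterior D)) v H V) :
    ∀ᵐ x ∂(volume.restrict (exterior D)), u x = v x → G x = H x := by
  let μ : Measure (E n) := volume.restrict (exterior D)
  have huvm : AEStronglyMeasurable (fun x => u x - v x) μ :=
    (hU.memLp.sub hV.memLp).aestronglyMeasurable
  have hset : NullMeasurableSet {x | u x - v x = 0} μ :=
    huvm.aemeasurable.nullMeasurable (measurableSet_singleton 0)
  have hGH : MemLp (fun x => G x - H x) P μ := hU.memLp_grad.sub hV.memLp_grad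
  let f : E n → E n := {x | u x - v x = 0}.indicator fun x => G x - H x
  have hf : MemLp f P μ := by
    refine hGH.mono (hGH.aestronglyMeasurable.indicator₀ hset) (Eventually.of_forall fun x => ?_)
    exact norm_indicator_le_norm_self _ _
  have hz := ae_eq_zero_of_forall_test (isOpen_exterior D) hP hf fun ζ hζ e => ?_
  · filter_upwards [hz] with x hx hxe
    have hmem : x ∈ {x | u x - v x = 0} := sub_eq_zero.2 hxe
    have hx' : G x - H x = 0 := by rwa [show f x = G x - H x from indicator_of_mem hmem _] at hx
    exact sub_eq_zero.1 hx'
  · have hζ1 : ContDiff ℝ 1 ζ := hζ.1.of_le (by exact_mod_cast le_top)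
    have hOut : ∀ k : ℕ, IsOuter
        (fun q => Real.arctan ((k + 1) * (q.1 - q.2)) / (k + 1))
        (fun q => 1 / (1 + ((k + 1) * (q.1 - q.2)) ^ 2))
        (fun q => -(1 / (1 + ((k + 1) * (q.1 - q.2)) ^ 2))) 1 := fun k => by
      refine isOuter_comp_sub (f := fun s => Real.arctan ((k + 1) * s) / (k + 1))
        (f' := fun s => 1 / (1 + ((k + 1) * s) ^ 2)) (by simp) (hasDerivAt_arctan_div k) ?_ ?_
      · exact continuous_const.div (by fun_prop) fun s => by positivity
      · intro s
        rw [abs_of_nonneg (by positivity), div_le_one (by positivity)]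
        linarith [sq_nonneg (((k : ℝ) + 1) * s)]
    have h0 := fun k => integral_inner_outerGrad_eq_zero hD hP (hOut k)
      (ζ := ζ) ⟨hζ.1, hζ.2.1, subset_univ _⟩ hU hV
      (fun k x hx h => (hζ.2.2 (tsupport_mul_subset_left h)) (frontier_subset_closure hx)) e
    have hform : ∀ (k : ℕ) x, outerGrad (fun q => Real.arctan ((k + 1) * (q.1 - q.2)) / (k + 1))
        (fun q => 1 / (1 + ((k + 1) * (q.1 - q.2)) ^ 2))
        (fun q => -(1 / (1 + ((k + 1) * (q.1 - q.2)) ^ 2))) ζ u v G H x =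
        (Real.arctan ((k + 1) * (u x - v x)) / (k + 1)) • ∇ ζ x +
          (1 / (1 + ((k + 1) * (u x - v x)) ^ 2)) • (ζ x • (G x - H x)) := by
      intro k x
      simp only [outerGrad]
      module
    simp only [hform] at h0
    have hζG : Integrable (fun x => ζ x • (G x - H x)) μ :=
      (hGH.locallyIntegrable hP).integrable_smul_left_of_hasCompactSupport
        hζ.1.continuous hζ.2.1
    have hζg : Integrable (∇ ζ) μ :=
      (continuous_gradient hζ1).integrable_of_hasCompactSupport
        (hζ.2.1.mono' fun x hx => by
          by_contra h
          exact hx (gradient_of_notMem_tsupport h))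
    have hlim : Tendsto (fun k : ℕ => ∫ x, inner ℝ e
        ((Real.arctan ((k + 1) * (u x - v x)) / (k + 1)) • ∇ ζ x +
          (1 / (1 + ((k + 1) * (u x - v x)) ^ 2)) • (ζ x • (G x - H x))) ∂μ) atTop
        (𝓝 (∫ x, ζ x * inner ℝ e (f x) ∂μ)) := by
      refine tendsto_integral_of_dominated_convergence
        (fun x => ‖e‖ * (2 * ‖∇ ζ x‖ + ‖ζ x • (G x - H x)‖)) (fun k => ?_)
        (((hζg.norm.const_mul 2).add hζG.norm).const_mul _)
        (fun k => Eventually.of_forall fun x => ?_) (Eventually.of_forall fun x => ?_)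
      · refine aestronglyMeasurable_const.inner (AEStronglyMeasurable.add ?_ ?_)
        · exact ((by fun_prop : Continuous fun s : ℝ =>
            Real.arctan ((k + 1) * s) / (k + 1)).comp_aestronglyMeasurable huvm).smul
            hζg.aestronglyMeasurable
        · exact ((continuous_const.div (by fun_prop) fun s => by positivity : Continuous fun s : ℝ =>
            1 / (1 + ((k + 1) * s) ^ 2)).comp_aestronglyMeasurable huvm).smul
            hζG.aestronglyMeasurable
      · refine (norm_inner_le_norm _ _).trans (mul_le_mul_of_nonneg_left ?_ (norm_nonneg _))
        refine (norm_add_le _ _).trans (add_le_add ?_ ?_)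
        · rw [norm_smul]
          refine mul_le_mul_of_nonneg_right ?_ (norm_nonneg _)
          rw [norm_div, Real.norm_eq_abs, Real.norm_eq_abs]
          have h1 : |Real.arctan ((k + 1) * (u x - v x))| ≤ 2 :=
            abs_le.2 ⟨by linarith [Real.neg_pi_div_two_lt_arctan ((k + 1) * (u x - v x)),
              Real.pi_le_four], by linarith [Real.arctan_lt_pi_div_two ((k + 1) * (u x - v x)),
              Real.pi_le_four]⟩
          have h2 : 1 ≤ |(k : ℝ) + 1| := by
            rw [abs_of_nonneg (by positivity)]; linarith [k.cast_nonneg (α := ℝ)]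
          exact (div_le_self (abs_nonneg _) h2).trans h1
        · rw [norm_smul, Real.norm_of_nonneg (by positivity)]
          refine mul_le_of_le_one_left (norm_nonneg _) ?_
          rw [div_le_one (by positivity)]
          linarith [sq_nonneg (((k : ℝ) + 1) * (u x - v x))]
      · have h1 : Tendsto (fun k : ℕ => Real.arctan ((k + 1) * (u x - v x)) / ((k : ℝ) + 1)) atTop
            (𝓝 0) := by
          rw [tendsto_zero_iff_norm_tendsto_zero]
          refine squeeze_zero (fun _ => norm_nonneg _) (fun k => ?_) (tendsto_const_div_add_one 2)
          rw [norm_div, Real.norm_of_nonneg (by positivity : (0 : ℝ) ≤ (k : ℝ) + 1)]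
          gcongr
          rw [Real.norm_eq_abs]
          exact abs_le.2 ⟨by linarith [Real.neg_pi_div_two_lt_arctan ((k + 1) * (u x - v x)),
              Real.pi_le_four], by linarith [Real.arctan_lt_pi_div_two ((k + 1) * (u x - v x)),
              Real.pi_le_four]⟩
        have h2 : Tendsto (fun k : ℕ => (1 / (1 + (((k : ℝ) + 1) * (u x - v x)) ^ 2)) •
            (ζ x • (G x - H x))) atTop (𝓝 (ζ x • f x)) := by
          by_cases hx : u x - v x = 0
          · have hfx : f x = G x - H x := indicator_of_mem (show x ∈ {x | u x - v x = 0} from hx) _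
            simp [hx, hfx]
          · have hfx : f x = 0 := indicator_of_notMem (show x ∉ {x | u x - v x = 0} from hx) _
            rw [hfx, smul_zero]
            have h3 : Tendsto (fun k : ℕ => 1 / (1 + (((k : ℝ) + 1) * (u x - v x)) ^ 2)) atTop
                (𝓝 0) := by
              refine Tendsto.div_atTop tendsto_const_nhds
                (tendsto_atTop_add_const_left _ _ ?_)
              simp only [mul_pow]
              refine Tendsto.atTop_mul_const (by positivity) ?_
              exact (tendsto_pow_atTop two_ne_zero).comp
                (tendsto_natCast_atTop_atTop.atTop_add tendsto_const_nhds)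
            simpa using h3.smul_const (ζ x • (G x - H x))
        have h4 := (h1.smul_const (∇ ζ x)).add h2
        rw [zero_smul, zero_add] at h4
        have h5 : Tendsto (fun k : ℕ => inner ℝ e
          ((Real.arctan ((k + 1) * (u x - v x)) / ((k : ℝ) + 1)) • ∇ ζ x +
          (1 / (1 + (((k : ℝ) + 1) * (u x - v x)) ^ 2)) • (ζ x • (G x - H x)))) atTop
          (𝓝 (inner ℝ e (ζ x • f x))) := tendsto_const_nhds.inner h4
        rwa [inner_smul_right] at h5
    exact tendsto_nhds_unique hlim (tendsto_const_nhds.congr fun k => (h0 k).symm)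

end LevelSet

/-! ### Maximum principle and uniqueness -/

section Potential

variable {D Ω : Set (E n)} {p : ℝ} {A : E n → E n → E n} {φ u v : E n → ℝ} {G H : E n → E n}
  {U V : ℕ → E n → ℝ}

lemma integrable_inner_gradient_of_isTest (hp : 1 < p) {W : Set (E n)} {μ : Measure (E n)}
    [IsFiniteMeasureOnCompacts μ] {Y : E n → E n}
    (hY : MemLp Y (ENNReal.ofReal p.conjExponent) μ) {ζ : E n → ℝ} (hζ : IsTest W ζ) :
    Integrable (fun x => inner ℝ (Y x) (∇ ζ x)) μ := by
  have := holderTriple_conjExponent hp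
  obtain ⟨K, hK⟩ := hζ.1.lipschitzWith_of_hasCompactSupport hζ.2.1 (by simp)
  exact integrable_inner_of_memLp hY (memLp_gradient (P := ENNReal.ofReal p) hK hζ.2.1)

lemma gradient_one (x : E n) : ∇ (fun _ : E n => (1 : ℝ)) x = 0 := by
  simp [gradient]

lemma outerGrad_one (h h₁ h₂ : ℝ × ℝ → ℝ) (x : E n) :
    outerGrad h h₁ h₂ (fun _ => 1) u v G H x = h₁ (u x, v x) • G x + h₂ (u x, v x) • H x := by
  simp [outerGrad, gradient_one]

/-- The maximum principle: a potential takes values between `0` and the maximum of the boundary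
data. -/
lemma IsPotential.ae_mem_Icc (hn : 1 ≤ n) (hp : 1 < p) (hD : IsOpen D)
    (hA : IsDegenerateElliptic D p A) (hΩ : IsConfiguration D Ω) (hu : IsPotential D p A φ Ω u G)
    {m : ℝ} (hm : 0 ≤ m) (hφ : ∀ x ∈ frontier D, 0 < φ x) (hφm : ∀ x ∈ frontier D, φ x ≤ m) :
    ∀ᵐ x ∂(volume.restrict (exterior D)), u x ∈ Icc 0 m := by
  have := holderTriple_conjExponent hp
  obtain ⟨U, hU⟩ := hu.exists_isApprox hp hD hΩ
  obtain ⟨l, L, hl, hlL, hell⟩ := hA.elliptic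
  have key : ∀ j, ∀ᵐ x ∂(volume.restrict (exterior D)), step j (u x - m) - step j (-u x) = 0 := by
    intro j
    obtain ⟨C, hC⟩ := exists_bound_deriv_step j
    have hstep' : Continuous (deriv (step j)) := (contDiff_step j).continuous_deriv_one
    -- the test function vanishes where `-1 / (j + 1) ≤ u ≤ m + 1 / (j + 1)`, so near `∂D` and outside
    -- `Ω`, and it is nondecreasing in `u`
    have hout := isOuter_comp_fst (f := fun s => step j (s - m) - step j (-s))
      (f' := fun s => deriv (step j) (s - m) + deriv (step j) (-s)) (C := C + C)
      (by
        rw [step_eq_zero_of_nonpos (by linarith), step_eq_zero_of_nonpos (by simp), sub_zero])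
      (fun s => by
        have h1 := (hasDerivAt_step j (s - m)).comp s ((hasDerivAt_id s).sub_const m)
        have h2 := (hasDerivAt_step j (-s)).comp s (hasDerivAt_neg s)
        exact (h1.sub h2).congr_deriv (by ring))
      (by fun_prop) (fun s => (abs_add_le _ _).trans (add_le_add (hC _) (hC _)))
    have hbd : ∀ k, ∀ x ∈ frontier D, x ∉ tsupport
        (fun x => step j (U k x - m) - step j (-U k x)) := by
      intro k x hx
      rw [notMem_tsupport_iff_eventuallyEq]
      have hc : Continuous (U k) := (hU.lip k).choose_spec.continuous
      have h1 : ∀ᶠ y in 𝓝 x, (j + 1 : ℝ) * (U k y - m) < 1 := by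
        refine ContinuousAt.eventually_lt (by fun_prop) continuousAt_const ?_
        rw [hU.boundary k x hx]
        nlinarith [hφm x hx, j.cast_nonneg (α := ℝ)]
      have h2 : ∀ᶠ y in 𝓝 x, (j + 1 : ℝ) * (-U k y) < 1 := by
        refine ContinuousAt.eventually_lt (by fun_prop) continuousAt_const ?_
        rw [hU.boundary k x hx]
        nlinarith [hφ x hx, j.cast_nonneg (α := ℝ)]
      filter_upwards [h1, h2] with y h1 h2
      simp [step_eq_zero h1.le, step_eq_zero h2.le]
    obtain ⟨hi, h0⟩ := integral_inner_outerGrad_eq_zero_of_equation (one_le_conjExponent hp) hD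
      hΩ.isOpen (hA.memLp_comp hp hu.memSobolev.memLp_grad) hu.equation hout
      (ζ := fun _ => 1) (B := 1) contDiff_const (by simp) (by simp [gradient_one])
      hU.toGradApprox hU.toGradApprox
      (fun k => (hout.tsupport_subset _ _ _).trans
        (union_subset (hU.tsupport_subset k) (hU.tsupport_subset k)))
      (fun k x hx => by simpa only [one_mul] using hbd k x hx)
    simp only [outerGrad_one, zero_smul, add_zero, inner_smul_right] at hi h0
    have hc' : ∀ x, 0 ≤ deriv (step j) (u x - m) + deriv (step j) (-u x) := fun x =>
      add_nonneg (deriv_step_nonneg _ _) (deriv_step_nonneg _ _)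
    have hnn : ∀ᵐ x ∂(volume.restrict (exterior D)), 0 ≤
        (deriv (step j) (u x - m) + deriv (step j) (-u x)) * inner ℝ (A x (G x)) (G x) := by
      filter_upwards [hell] with x hx
      exact mul_nonneg (hc' x) ((mul_nonneg hl.le (Real.rpow_nonneg (norm_nonneg _) _)).trans
        (hx (G x)).1)
    -- ellipticity makes the tested integrand nonnegative, so the test function has no gradient
    have hz := (integral_eq_zero_iff_of_nonneg_ae hnn hi).1 h0
    have hgz : ∀ᵐ x ∂(volume.restrict (exterior D)),
        (deriv (step j) (u x - m) + deriv (step j) (-u x)) • G x + (0 : ℝ) • G x = 0 := by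
      filter_upwards [hz, hell] with x hx hxe
      rw [zero_smul, add_zero, smul_eq_zero]
      rcases mul_eq_zero.1 hx with h | h
      · exact Or.inl h
      · right
        have h1 := (hxe (G x)).1
        rw [h] at h1
        by_contra hG
        have : 0 < l * ‖G x‖ ^ p := mul_pos hl (Real.rpow_pos_of_pos (norm_pos_iff.2 hG) _)
        linarith
    exact outer_ae_eq_zero hn (one_le_ofReal hp) hD hΩ hout (M := 1)
      (fun q => abs_le.2 ⟨by linarith [step_nonneg j (q.1 - m), step_le_one j (-q.1)],
        by linarith [step_nonneg j (-q.1), step_le_one j (q.1 - m)]⟩)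
      hU.toGradApprox hU.toGradApprox hu.zero_outside hu.zero_outside hbd hgz
  filter_upwards [ae_all_iff.2 key] with x hx
  constructor
  · by_contra! hneg
    obtain ⟨j, hj⟩ := exists_step_eq_one (neg_pos.2 hneg)
    have h1 := hx j
    rw [hj, step_eq_zero_of_nonpos (by linarith)] at h1
    norm_num at h1
  · by_contra! hbig
    obtain ⟨j, hj⟩ := exists_step_eq_one (sub_pos.2 hbig)
    have h1 := hx j
    rw [hj, step_eq_zero_of_nonpos (by linarith)] at h1
    norm_num at h1

/-- The potential of a configuration is unique. -/
lemma IsPotential.ae_grad_eq (hn : 1 ≤ n) (hp : 1 < p) (hD : IsOpen D)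
    (hA : IsDegenerateElliptic D p A) (hΩ : IsConfiguration D Ω) (hu : IsPotential D p A φ Ω u G)
    (hv : IsPotential D p A φ Ω v H) : G =ᵐ[volume.restrict (exterior D)] H := by
  have := holderTriple_conjExponent hp
  obtain ⟨U, hU⟩ := hu.exists_isApprox hp hD hΩ
  obtain ⟨V, hV⟩ := hv.exists_isApprox hp hD hΩ
  have hYG := hA.memLp_comp hp hu.memSobolev.memLp_grad
  have hYH := hA.memLp_comp hp hv.memSobolev.memLp_grad
  have key : ∀ j, ∀ᵐ x ∂(volume.restrict (exterior D)),
      step j (u x - v x) - step j (-(u x - v x)) = 0 := by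
    intro j
    obtain ⟨C, hC⟩ := exists_bound_deriv_step j
    have hstep' : Continuous (deriv (step j)) := (contDiff_step j).continuous_deriv_one
    have hout := isOuter_comp_sub (f := fun s => step j s - step j (-s))
      (f' := fun s => deriv (step j) s + deriv (step j) (-s)) (C := C + C) (by simp)
      (fun s => by
        have h2 := (hasDerivAt_step j (-s)).comp s (hasDerivAt_neg s)
        exact ((hasDerivAt_step j s).sub h2).congr_deriv (by ring))
      (by fun_prop) (fun s => (abs_add_le _ _).trans (add_le_add (hC _) (hC _)))
    have hbd : ∀ k, ∀ x ∈ frontier D, x ∉ tsupport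
        (fun x => step j (U k x - V k x) - step j (-(U k x - V k x))) := by
      intro k x hx
      rw [notMem_tsupport_iff_eventuallyEq]
      have hcU : Continuous (U k) := (hU.lip k).choose_spec.continuous
      have hcV : Continuous (V k) := (hV.lip k).choose_spec.continuous
      have h1 : ∀ᶠ y in 𝓝 x, (j + 1 : ℝ) * (U k y - V k y) < 1 := by
        refine ContinuousAt.eventually_lt (by fun_prop) continuousAt_const ?_
        rw [hU.boundary k x hx, hV.boundary k x hx]
        simp
      have h2 : ∀ᶠ y in 𝓝 x, (j + 1 : ℝ) * (-(U k y - V k y)) < 1 := by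
        refine ContinuousAt.eventually_lt (by fun_prop) continuousAt_const ?_
        rw [hU.boundary k x hx, hV.boundary k x hx]
        simp
      filter_upwards [h1, h2] with y h1 h2
      simp only [step_eq_zero h1.le, step_eq_zero h2.le, sub_zero, Pi.zero_apply]
    obtain ⟨hi, h0⟩ := integral_inner_outerGrad_eq_zero_of_equation (one_le_conjExponent hp) hD
      hΩ.isOpen (hYG.sub hYH)
      (fun ψ hψ => by
        simp only [Pi.sub_apply, inner_sub_left]
        rw [integral_sub (integrable_inner_gradient_of_isTest hp hYG hψ)
          (integrable_inner_gradient_of_isTest hp hYH hψ), hu.equation ψ hψ, hv.equation ψ hψ,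
          sub_zero])
      hout (ζ := fun _ => 1) (B := 1) contDiff_const (by simp) (by simp [gradient_one])
      hU.toGradApprox hV.toGradApprox
      (fun k => (hout.tsupport_subset _ _ _).trans
        (union_subset (hU.tsupport_subset k) (hV.tsupport_subset k)))
      (fun k x hx => by simpa only [one_mul] using hbd k x hx)
    have hform : ∀ x, (deriv (step j) (u x - v x) + deriv (step j) (-(u x - v x))) • G x +
        (-(deriv (step j) (u x - v x) + deriv (step j) (-(u x - v x)))) • H x =
        (deriv (step j) (u x - v x) + deriv (step j) (-(u x - v x))) • (G x - H x) := by
      intro x; module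
    simp only [outerGrad_one, hform, inner_smul_right] at hi h0
    have hc' : ∀ x, 0 ≤ deriv (step j) (u x - v x) + deriv (step j) (-(u x - v x)) := fun x =>
      add_nonneg (deriv_step_nonneg _ _) (deriv_step_nonneg _ _)
    have hnn : ∀ᵐ x ∂(volume.restrict (exterior D)), 0 ≤
        (deriv (step j) (u x - v x) + deriv (step j) (-(u x - v x))) *
          inner ℝ (((fun x => A x (G x)) - fun x => A x (H x)) x) (G x - H x) := by
      filter_upwards [hA.monotone] with x hx
      refine mul_nonneg (hc' x) ?_
      by_cases hGH : G x = H x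
      · simp [hGH]
      · exact (hx _ _ hGH).le
    -- by strict monotonicity, the gradients agree wherever the test function is not stationary
    have hz := (integral_eq_zero_iff_of_nonneg_ae hnn hi).1 h0
    refine outer_ae_eq_zero hn (one_le_ofReal hp) hD hΩ hout (M := 1)
      (fun q => abs_le.2 ⟨by linarith [step_nonneg j (q.1 - q.2), step_le_one j (-(q.1 - q.2))],
        by linarith [step_nonneg j (-(q.1 - q.2)), step_le_one j (q.1 - q.2)]⟩)
      hU.toGradApprox hV.toGradApprox hu.zero_outside hv.zero_outside hbd ?_
    filter_upwards [hz, hA.monotone] with x hx hxm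
    rw [hform, smul_eq_zero]
    rcases mul_eq_zero.1 hx with h | h
    · exact Or.inl h
    · right
      by_contra hGH
      exact absurd h (hxm _ _ (sub_ne_zero.1 hGH)).ne'
  filter_upwards [ae_all_iff.2 key,
    ae_grad_eq_of_eq hD (one_le_ofReal hp) hU.toGradApprox hV.toGradApprox] with x hx hx'
  refine hx' ?_
  rcases lt_trichotomy (u x) (v x) with h | h | h
  · obtain ⟨j, hj⟩ := exists_step_eq_one (sub_pos.2 h)
    have h1 := hx j
    rw [neg_sub, hj, step_eq_zero_of_nonpos (by linarith)] at h1
    norm_num at h1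
  · exact h
  · obtain ⟨j, hj⟩ := exists_step_eq_one (sub_pos.2 h)
    have h1 := hx j
    rw [neg_sub, hj, step_eq_zero_of_nonpos (by linarith)] at h1
    norm_num at h1

end Potential

/-! ### Comparison of fluxes through the boundary -/

section Comparison

variable {D Ω O : Set (E n)} {p : ℝ} {A : E n → E n → E n} {φ u v : E n → ℝ} {G H : E n → E n}
  {m : ℝ}

/-- Kato's inequality up to the boundary, with a smooth step in place of the indicator function of
`{v < u}`: there, the difference of the fluxes of two potentials with the same data on `∂D` has
nonpositive pairing with the gradient of a nonnegative function. The function `ζ` need not vanish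
on `∂D`, and its support may leave the configuration of `u`, because `u = 0 ≤ v` outside. -/
lemma IsPotential.integral_step_mul_inner_le_zero (hn : 1 ≤ n) (hp : 1 < p) (hD : IsOpen D)
    (hA : IsDegenerateElliptic D p A) (hm : 0 ≤ m) (hφ : ∀ x ∈ frontier D, 0 < φ x)
    (hφm : ∀ x ∈ frontier D, φ x ≤ m)
    (hΩ : IsConfiguration D Ω) (hu : IsPotential D p A φ Ω u G)
    (hO : IsConfiguration D O) (hv : IsPotential D p A φ O v H)
    {ζ : E n → ℝ} (hζ : IsTest O ζ) (hζ0 : ∀ x, 0 ≤ ζ x) (j : ℕ) :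
    ∫ x in exterior D, step j (u x - v x) * inner ℝ (A x (G x) - A x (H x)) (∇ ζ x) ≤ 0 := by
  have := holderTriple_conjExponent hp
  obtain ⟨U, hU⟩ := hu.exists_isApprox hp hD hΩ
  obtain ⟨V, hV⟩ := hv.exists_isApprox hp hD hO
  have hYG := hA.memLp_comp hp hu.memSobolev.memLp_grad
  have hYH := hA.memLp_comp hp hv.memSobolev.memLp_grad
  obtain ⟨B, hB, hB'⟩ := exists_bound_of_isTest hζ
  have hζ1 : ContDiff ℝ 1 ζ := hζ.1.of_le (by exact_mod_cast le_top)
  obtain ⟨C, hC⟩ := exists_bound_deriv_step j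
  obtain ⟨C', hC'⟩ := exists_bound_deriv_step (2 * j + 1)
  have habs : ∀ i s, |step i s| ≤ 1 := fun i s =>
    abs_le.2 ⟨by linarith [step_nonneg i s], step_le_one i s⟩
  -- the second factor is `1` wherever the first one does not vanish and `v ≥ 0`; it forces the
  -- approximations to have support in `Ω`
  have hout := (isOuter_comp_sub (step_eq_zero_of_nonpos (j := j) le_rfl) (hasDerivAt_step j)
    (contDiff_step j).continuous_deriv_one hC).mul
    (isOuter_comp_fst (step_eq_zero_of_nonpos (j := 2 * j + 1) le_rfl)
      (hasDerivAt_step (2 * j + 1)) (contDiff_step (2 * j + 1)).continuous_deriv_one hC')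
    (fun q => habs j _) (fun q => habs (2 * j + 1) _)
  obtain ⟨hi, h0⟩ := integral_inner_outerGrad_eq_zero_of_equation (one_le_conjExponent hp) hD
    (hΩ.isOpen.inter hO.isOpen) (hYG.sub hYH)
    (fun ψ hψ => by
      simp only [Pi.sub_apply, inner_sub_left]
      rw [integral_sub (integrable_inner_gradient_of_isTest hp hYG hψ)
        (integrable_inner_gradient_of_isTest hp hYH hψ),
        hu.equation ψ ⟨hψ.1, hψ.2.1, hψ.2.2.trans (sdiff_subset_sdiff_left inter_subset_left)⟩,
        hv.equation ψ ⟨hψ.1, hψ.2.1, hψ.2.2.trans (sdiff_subset_sdiff_left inter_subset_right)⟩,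
        sub_zero])
    hout hζ1 hB hB' hU.toGradApprox hV.toGradApprox
    (fun k => by
      refine subset_inter ?_ (tsupport_mul_subset_left.trans hζ.2.2)
      refine (closure_mono fun x hx => ?_).trans (hU.tsupport_subset k)
      intro hx0
      refine hx ?_
      simp only [hx0, step_eq_zero_of_nonpos le_rfl, mul_zero])
    (fun k x hx => by
      rw [notMem_tsupport_iff_eventuallyEq]
      have hcU : Continuous (U k) := (hU.lip k).choose_spec.continuous
      have hcV : Continuous (V k) := (hV.lip k).choose_spec.continuous
      have h1 : ∀ᶠ y in 𝓝 x, (j + 1 : ℝ) * (U k y - V k y) < 1 := by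
        refine ContinuousAt.eventually_lt (by fun_prop) continuousAt_const ?_
        rw [hU.boundary k x hx, hV.boundary k x hx]
        simp
      filter_upwards [h1] with y h1
      simp only [step_eq_zero h1.le, zero_mul, mul_zero, Pi.zero_apply])
  have hum := hU.memLp.aestronglyMeasurable
  have hvm := hV.memLp.aestronglyMeasurable
  have hI : Integrable (fun x => step j (u x - v x) *
      inner ℝ (A x (G x) - A x (H x)) (∇ ζ x)) (volume.restrict (exterior D)) :=
    (integrable_inner_gradient_of_isTest hp (hYG.sub hYH) hζ).bdd_mul
      ((contDiff_step j).continuous.comp_aestronglyMeasurable (hum.sub hvm))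
      (Eventually.of_forall fun x => habs j _)
  rw [← h0]
  refine integral_mono_ae hI hi ?_
  filter_upwards [hA.monotone, hv.ae_mem_Icc hn hp hD hA hO hm hφ hφm] with x hmon hvx
  have hmono : 0 ≤ inner ℝ (A x (G x) - A x (H x)) (G x - H x) := by
    by_cases hGH : G x = H x
    · simp [hGH]
    · exact (hmon _ _ hGH).le
  have hj0 : (0 : ℝ) < j + 1 := by positivity
  have hcast : ((2 * j + 1 : ℕ) : ℝ) + 1 = 2 * (j + 1) := by push_cast; ring
  have hgrad : outerGrad (fun q : ℝ × ℝ => step j (q.1 - q.2) * step (2 * j + 1) q.1)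
      (fun q => step j (q.1 - q.2) * deriv (step (2 * j + 1)) q.1 +
        step (2 * j + 1) q.1 * deriv (step j) (q.1 - q.2))
      (fun q => step j (q.1 - q.2) * 0 + step (2 * j + 1) q.1 * -deriv (step j) (q.1 - q.2))
      ζ u v G H x = step j (u x - v x) • ∇ ζ x +
        (ζ x * deriv (step j) (u x - v x)) • (G x - H x) := by
    rcases lt_or_ge ((j + 1 : ℝ) * (u x - v x)) 1 with hlt | hge
    · simp [outerGrad, step_eq_zero hlt.le, deriv_step_eq_zero (Or.inl hlt)]
    · have h2 : 2 ≤ (((2 * j + 1 : ℕ) : ℝ) + 1) * u x := by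
        rw [hcast]; nlinarith [hvx.1]
      have h3 : step j (u x - v x) * deriv (step (2 * j + 1)) (u x) = 0 := by
        rcases hge.eq_or_lt with heq | hgt
        · rw [step_eq_zero heq.symm.le, zero_mul]
        · rw [deriv_step_eq_zero, mul_zero]
          right
          rw [hcast]
          nlinarith [hvx.1]
      simp only [outerGrad, step_eq_one h2, h3]
      module
  rw [hgrad, inner_add_right, inner_smul_right, inner_smul_right]
  exact le_add_of_nonneg_right
    (mul_nonneg (mul_nonneg (hζ0 x) (deriv_step_nonneg _ _)) hmono)

/-- The flux of a potential through `∂D` exceeds that of another one with the same data on `∂D`,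
up to an error that only involves the two potentials away from `∂D`, where `∇χ` lives. -/
lemma IsPotential.neg_integral_abs_le (hn : 1 ≤ n) (hp : 1 < p) (hD : IsOpen D)
    (hA : IsDegenerateElliptic D p A) (hm : 0 ≤ m) (hφ : ∀ x ∈ frontier D, 0 < φ x)
    (hφm : ∀ x ∈ frontier D, φ x ≤ m)
    (hΩ : IsConfiguration D Ω) (hu : IsPotential D p A φ Ω u G)
    (hO : IsConfiguration D O) (hv : IsPotential D p A φ O v H)
    {ψ χ : E n → ℝ} (hψ : IsTest (Ω ∩ O) ψ) (hψ0 : ∀ x, 0 ≤ ψ x) (hχ : IsTest O χ)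
    (hψχ : ∀ x, ψ x ≤ χ x) :
    -∫ x in exterior D, |inner ℝ (A x (G x) - A x (H x)) (∇ χ x)| ≤
      ∫ x in exterior D, inner ℝ (A x (G x) - A x (H x)) (∇ ψ x) := by
  let μ : Measure (E n) := volume.restrict (exterior D)
  obtain ⟨U, hU⟩ := hu.exists_isApprox hp hD hΩ
  obtain ⟨V, hV⟩ := hv.exists_isApprox hp hD hO
  have hum := hU.memLp.aestronglyMeasurable
  have hvm := hV.memLp.aestronglyMeasurable
  have hY := (hA.memLp_comp hp hu.memSobolev.memLp_grad).sub
    (hA.memLp_comp hp hv.memSobolev.memLp_grad)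
  have habs : ∀ i s, |step i s| ≤ 1 := fun i s =>
    abs_le.2 ⟨by linarith [step_nonneg i s], step_le_one i s⟩
  have hIψ : Integrable (fun x => inner ℝ (A x (G x) - A x (H x)) (∇ ψ x)) μ :=
    integrable_inner_gradient_of_isTest hp hY hψ
  have hIχ : Integrable (fun x => inner ℝ (A x (G x) - A x (H x)) (∇ χ x)) μ :=
    integrable_inner_gradient_of_isTest hp hY hχ
  have hsm : ∀ j, AEStronglyMeasurable (fun x => step j (u x - v x)) μ := fun j =>
    (contDiff_step j).continuous.comp_aestronglyMeasurable (hum.sub hvm)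
  have hsm' : ∀ j, AEStronglyMeasurable (fun x => step j (v x - u x)) μ := fun j =>
    (contDiff_step j).continuous.comp_aestronglyMeasurable (hvm.sub hum)
  have hlow : ∀ j, -∫ x in exterior D, |inner ℝ (A x (G x) - A x (H x)) (∇ χ x)| ≤
      ∫ x in exterior D, (step j (u x - v x) + step j (v x - u x)) *
        inner ℝ (A x (G x) - A x (H x)) (∇ ψ x) := by
    intro j
    have hζ : IsTest O (fun x => χ x - ψ x) := by
      refine ⟨hχ.1.sub hψ.1, hχ.2.1.sub hψ.2.1, (tsupport_sub _ _).trans ?_⟩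
      exact union_subset hχ.2.2 (hψ.2.2.trans inter_subset_right)
    -- Kato's inequality on `{v < u}` with weight `χ - ψ`, and on `{u < v}` with weight `ψ`
    have k1 := hu.integral_step_mul_inner_le_zero hn hp hD hA hm hφ hφm hΩ hO hv hζ
      (fun x => sub_nonneg.2 (hψχ x)) j
    have k2 := hv.integral_step_mul_inner_le_zero hn hp hD hA hm hφ hφm hO hΩ hu
      ⟨hψ.1, hψ.2.1, hψ.2.2.trans inter_subset_left⟩ hψ0 j
    have hg : ∀ x, ∇ (fun x => χ x - ψ x) x = ∇ χ x - ∇ ψ x := by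
      intro x
      have h1 : fderiv ℝ (fun x => χ x - ψ x) x = fderiv ℝ χ x - fderiv ℝ ψ x :=
        fderiv_sub (hχ.1.differentiable (by simp) x) (hψ.1.differentiable (by simp) x)
      simp [gradient, h1]
    have i1 : Integrable (fun x => step j (u x - v x) *
        inner ℝ (A x (G x) - A x (H x)) (∇ ψ x)) μ :=
      hIψ.bdd_mul (hsm j) (Eventually.of_forall fun x => habs j _)
    have i2 : Integrable (fun x => step j (v x - u x) *
        inner ℝ (A x (G x) - A x (H x)) (∇ ψ x)) μ :=
      hIψ.bdd_mul (hsm' j) (Eventually.of_forall fun x => habs j _)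
    have i3 : Integrable (fun x => step j (u x - v x) *
        inner ℝ (A x (G x) - A x (H x)) (∇ χ x)) μ :=
      hIχ.bdd_mul (hsm j) (Eventually.of_forall fun x => habs j _)
    simp only [hg, inner_sub_right, mul_sub] at k1
    rw [integral_sub i3 i1] at k1
    have k2' : 0 ≤ ∫ x in exterior D, step j (v x - u x) *
        inner ℝ (A x (G x) - A x (H x)) (∇ ψ x) := by
      rw [← neg_nonpos, ← integral_neg]
      refine le_of_eq_of_le (integral_congr_ae (Eventually.of_forall fun x => ?_)) k2
      simp only [inner_sub_left]
      ring
    have k3 : -∫ x in exterior D, |inner ℝ (A x (G x) - A x (H x)) (∇ χ x)| ≤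
        ∫ x in exterior D, step j (u x - v x) * inner ℝ (A x (G x) - A x (H x)) (∇ χ x) := by
      rw [← integral_neg]
      refine integral_mono hIχ.abs.neg i3 fun x => ?_
      refine (neg_le_neg ?_).trans (neg_abs_le _)
      rw [abs_mul]
      exact mul_le_of_le_one_left (abs_nonneg _) (habs j _)
    simp only [add_mul]
    rw [integral_add i1 i2]
    linarith
  -- as `j → ∞` the steps add up to the indicator function of `{u ≠ v}`, off which the fluxes agree
  refine ge_of_tendsto' (tendsto_integral_of_dominated_convergence
    (fun x => 2 * |inner ℝ (A x (G x) - A x (H x)) (∇ ψ x)|) (fun j => ?_)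
    (hIψ.abs.const_mul _) (fun j => Eventually.of_forall fun x => ?_) ?_) hlow
  · exact ((hsm j).add (hsm' j)).mul hIψ.aestronglyMeasurable
  · rw [norm_mul]
    refine mul_le_mul_of_nonneg_right ?_ (abs_nonneg _)
    exact (abs_add_le _ _).trans (by linarith [habs j (u x - v x), habs j (v x - u x)])
  · filter_upwards [ae_grad_eq_of_eq hD (one_le_ofReal hp) hU.toGradApprox hV.toGradApprox]
      with x hx
    rcases lt_trichotomy (u x) (v x) with h | h | h
    · have h1 := ((tendsto_const_nhds (x := (0 : ℝ))).add (tendsto_step (sub_pos.2 h))).mul_const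
        (inner ℝ (A x (G x) - A x (H x)) (∇ ψ x))
      rw [zero_add, one_mul] at h1
      refine h1.congr fun j => ?_
      rw [step_eq_zero_of_nonpos (s := u x - v x) (by linarith)]
    · simp [hx h]
    · have h1 := ((tendsto_step (sub_pos.2 h)).add (tendsto_const_nhds (x := (0 : ℝ)))).mul_const
        (inner ℝ (A x (G x) - A x (H x)) (∇ ψ x))
      rw [add_zero, one_mul] at h1
      refine h1.congr fun j => ?_
      rw [step_eq_zero_of_nonpos (s := v x - u x) (by linarith)]

end Comparison

/-! ### Energy away from the boundary -/

section Caccioppoli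

variable {D : Set (E n)} {p : ℝ} {A : E n → E n → E n} {φ : E n → ℝ} {m : ℝ}

/-- A form of Young's inequality in which the weight `ξ` loses one power. -/
lemma pow_mul_rpow_le (hp : 1 < p) {N : ℕ} (hN : p ≤ N) {ξ t δ : ℝ} (hξ0 : 0 ≤ ξ)
    (hξ1 : ξ ≤ 1) (ht : 0 ≤ t) (hδ : 0 < δ) :
    ξ ^ (N - 1) * t ^ (p - 1) ≤ δ * (ξ ^ N * t ^ p) + (δ⁻¹) ^ (p - 1) := by
  have hN1 : 1 ≤ N := by
    have : (1 : ℝ) < N := hp.trans_le hN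
    exact_mod_cast this.le
  have hr : 0 ≤ (δ⁻¹) ^ (p - 1) := Real.rpow_nonneg (by positivity) _
  have hpow : ξ ^ N = ξ ^ (N - 1) * ξ := by
    rw [← pow_succ, Nat.sub_add_cancel hN1]
  rcases le_or_gt 1 (δ * ξ * t) with h | h
  · have ht0 : 0 < t := by
      rcases ht.eq_or_lt with h0 | h0
      · rw [← h0] at h; norm_num at h
      · exact h0
    have htp : t ^ p = t ^ (p - 1) * t := by
      rw [Real.rpow_sub_one ht0.ne', div_mul_cancel₀ _ ht0.ne']
    have h1 : 0 ≤ ξ ^ (N - 1) * t ^ (p - 1) := mul_nonneg (by positivity) (by positivity)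
    rw [hpow, htp]
    nlinarith [mul_le_mul_of_nonneg_left h h1]
  · have h1 : ξ ^ (N - 1) * t ^ (p - 1) ≤ (ξ * t) ^ (p - 1) := by
      rw [Real.mul_rpow hξ0 ht]
      refine mul_le_mul_of_nonneg_right ?_ (by positivity)
      rw [← Real.rpow_natCast]
      rcases hξ0.eq_or_lt with h0 | h0
      · have hN2 : ((N - 1 : ℕ) : ℝ) ≠ 0 := by
          have : (1 : ℝ) < N := hp.trans_le hN
          rw [Nat.cast_sub hN1]
          push_cast
          linarith
        rw [← h0, Real.zero_rpow hN2, Real.zero_rpow (by linarith)]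
      · refine Real.rpow_le_rpow_of_exponent_ge h0 hξ1 ?_
        rw [Nat.cast_sub hN1]
        push_cast
        linarith
    have h2 : (ξ * t) ^ (p - 1) ≤ (δ⁻¹) ^ (p - 1) := by
      refine Real.rpow_le_rpow (by positivity) ?_ (by linarith)
      rw [← one_div, le_div_iff₀ hδ]
      linarith
    have h3 : 0 ≤ δ * (ξ ^ N * t ^ p) := by positivity
    linarith

lemma gradient_pow {ξ : E n → ℝ} {x : E n} (hξ : DifferentiableAt ℝ ξ x) (N : ℕ) :
    ∇ (fun x => ξ x ^ N) x = (N * ξ x ^ (N - 1)) • ∇ ξ x := by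
  refine ext_inner_right ℝ fun v => ?_
  rw [inner_gradient_eq, real_inner_smul_left, inner_gradient_eq, (hξ.hasFDerivAt.pow N).fderiv]
  simp

lemma tsupport_pow_subset (ξ : E n → ℝ) {N : ℕ} (hN : N ≠ 0) :
    tsupport (fun x => ξ x ^ N) ⊆ tsupport ξ :=
  closure_mono fun x hx h0 => hx (by simp [h0, hN])

/-- The Caccioppoli inequality: away from `∂D`, the energy of a potential is bounded independently
of the configuration. -/
lemma exists_bound_integral_pow_mul_rpow (hn : 1 ≤ n) (hp : 1 < p) (hD : IsOpen D)
    (hA : IsDegenerateElliptic D p A) (hm : 0 ≤ m) (hφ : ∀ x ∈ frontier D, 0 < φ x)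
    (hφm : ∀ x ∈ frontier D, φ x ≤ m) {ξ : E n → ℝ} (hξ : IsTest (exterior D) ξ)
    (hξ0 : ∀ x, 0 ≤ ξ x) (hξ1 : ∀ x, ξ x ≤ 1) {N : ℕ} (hN : p ≤ N) :
    ∃ C : ℝ, ∀ (Ω : Set (E n)) (u : E n → ℝ) (G : E n → E n), IsConfiguration D Ω →
      IsPotential D p A φ Ω u G →
      Integrable (fun x => ξ x ^ N * ‖G x‖ ^ p) (volume.restrict (exterior D)) ∧
      ∫ x in exterior D, ξ x ^ N * ‖G x‖ ^ p ≤ C := by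
  have := holderTriple_conjExponent hp
  obtain ⟨l, L, hl, hlL, hell⟩ := hA.elliptic
  have hL : 0 ≤ L := hl.le.trans hlL
  obtain ⟨B, hB, hB'⟩ := exists_bound_of_isTest hξ
  have hB0 : 0 ≤ B := (abs_nonneg _).trans (hB 0)
  have hd : ∀ x, DifferentiableAt ℝ ξ x := hξ.1.differentiable (by simp)
  -- the constant in front of Young's inequality, and `δ` small enough to absorb half of the energy
  let a : ℝ := m * L * N * B
  have ha : 0 ≤ a := by positivity
  let δ : ℝ := l / (2 * (a + 1))
  have hδ : 0 < δ := by positivity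
  have haδ : a * δ ≤ l / 2 := by
    have : a * δ = l / 2 * (a / (a + 1)) := by
      simp only [δ]; field_simp
    rw [this]
    refine mul_le_of_le_one_right (by positivity) ?_
    rw [div_le_one (by positivity)]
    linarith
  let μ : Measure (E n) := volume.restrict (exterior D)
  let S : Set (E n) := tsupport ξ
  have hS : IntegrableOn (fun _ : E n => a * (δ⁻¹) ^ (p - 1)) S μ :=
    integrableOn_const hξ.2.1.isCompact.measure_lt_top.ne
  have hS' : Integrable (S.indicator fun _ : E n => a * (δ⁻¹) ^ (p - 1)) μ :=
    (integrable_indicator_iff (isClosed_tsupport ξ).measurableSet).2 hS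
  refine ⟨2 / l * ∫ x, S.indicator (fun _ => a * (δ⁻¹) ^ (p - 1)) x ∂μ, ?_⟩
  intro Ω u G hΩ hu
  obtain ⟨U, hU⟩ := hu.exists_isApprox hp hD hΩ
  have hGp : Integrable (fun x => ‖G x‖ ^ p) μ := by
    have := hu.memSobolev.memLp_grad.integrable_norm_rpow
      (zero_lt_one.trans_le (one_le_ofReal hp)).ne' ENNReal.ofReal_ne_top
    rwa [ENNReal.toReal_ofReal (by linarith)] at this
  have hξN : ContDiff ℝ 1 (fun x => ξ x ^ N) := (hξ.1.of_le (by exact_mod_cast le_top)).pow N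
  have hpow1 : ∀ (k : ℕ) x, |ξ x ^ k| ≤ 1 := fun k x => by
    rw [abs_of_nonneg (pow_nonneg (hξ0 x) _)]
    exact pow_le_one₀ (hξ0 x) (hξ1 x)
  have hI : Integrable (fun x => ξ x ^ N * ‖G x‖ ^ p) μ :=
    hGp.bdd_mul hξN.continuous.aestronglyMeasurable (Eventually.of_forall fun x => hpow1 N x)
  refine ⟨hI, ?_⟩
  have hts := tsupport_pow_subset ξ (N := N) (by rintro rfl; norm_num at hN; linarith)
  obtain ⟨hi, h0⟩ := integral_inner_outerGrad_eq_zero_of_equation (one_le_conjExponent hp) hD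
    hΩ.isOpen (hA.memLp_comp hp hu.memSobolev.memLp_grad) hu.equation isOuter_fst hξN
    (B := max 1 (N * B)) (fun x => (hpow1 N x).trans (le_max_left _ _))
    (fun x => by
      rw [gradient_pow (hd x), norm_smul, norm_mul, Real.norm_natCast]
      refine (mul_le_mul (mul_le_of_le_one_right (by positivity) (hpow1 _ x)) (hB' x)
        (norm_nonneg _) (by positivity)).trans (le_max_right _ _))
    hU.toGradApprox hU.toGradApprox
    (fun k => (isOuter_fst.tsupport_subset _ _ _).trans
      (union_subset (hU.tsupport_subset k) (hU.tsupport_subset k)))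
    (fun k x hx h => hξ.2.2 (hts (tsupport_mul_subset_left h)) (frontier_subset_closure hx))
  have hmain : ∫ x, l / 2 * (ξ x ^ N * ‖G x‖ ^ p) ∂μ ≤
      ∫ x, (inner ℝ (A x (G x)) (outerGrad Prod.fst (fun _ => 1) (fun _ => 0)
        (fun x => ξ x ^ N) u u G G x) + S.indicator (fun _ => a * (δ⁻¹) ^ (p - 1)) x) ∂μ := by
    refine integral_mono_ae (hI.const_mul _) (hi.add hS') ?_
    filter_upwards [hell, hu.ae_mem_Icc hn hp hD hA hΩ hm hφ hφm] with x hx hux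
    simp only [outerGrad, mul_one, mul_zero, zero_smul, add_zero, inner_add_right,
      inner_smul_right, gradient_pow (hd x)]
    by_cases hxS : x ∈ S
    · rw [indicator_of_mem hxS]
      have h1 : l * (ξ x ^ N * ‖G x‖ ^ p) ≤ ξ x ^ N * inner ℝ (A x (G x)) (G x) := by
        have := mul_le_mul_of_nonneg_left (hx (G x)).1 (pow_nonneg (hξ0 x) N)
        linarith
      have h2 : |u x * ((N * ξ x ^ (N - 1)) * inner ℝ (A x (G x)) (∇ ξ x))| ≤
          a * (ξ x ^ (N - 1) * ‖G x‖ ^ (p - 1)) := by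
        have h3 : |(inner ℝ (A x (G x)) (∇ ξ x) : ℝ)| ≤ L * ‖G x‖ ^ (p - 1) * B :=
          (abs_real_inner_le_norm _ _).trans (mul_le_mul (hx (G x)).2 (hB' x) (norm_nonneg _)
            (by positivity))
        have h4 : 0 ≤ N * ξ x ^ (N - 1) := mul_nonneg (by positivity) (pow_nonneg (hξ0 x) _)
        rw [abs_mul, abs_mul, abs_of_nonneg hux.1, abs_of_nonneg h4]
        calc u x * (N * ξ x ^ (N - 1) * |inner ℝ (A x (G x)) (∇ ξ x)|)
            ≤ m * (N * ξ x ^ (N - 1) * (L * ‖G x‖ ^ (p - 1) * B)) := by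
              refine mul_le_mul hux.2 (mul_le_mul_of_nonneg_left h3 h4)
                (mul_nonneg h4 (abs_nonneg _)) hm
          _ = a * (ξ x ^ (N - 1) * ‖G x‖ ^ (p - 1)) := by simp only [a]; ring
      have h5 := mul_le_mul_of_nonneg_left
        (pow_mul_rpow_le hp hN (hξ0 x) (hξ1 x) (norm_nonneg (G x)) hδ) ha
      have h6 : 0 ≤ ξ x ^ N * ‖G x‖ ^ p := mul_nonneg (pow_nonneg (hξ0 x) _) (by positivity)
      have h7 := mul_le_mul_of_nonneg_right haδ h6
      have h8 := (abs_le.1 h2).1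
      nlinarith
    · have h1 : ξ x = 0 := image_eq_zero_of_notMem_tsupport hxS
      have h2 : ξ x ^ N = 0 := image_eq_zero_of_notMem_tsupport (f := fun x => ξ x ^ N)
        fun h => hxS (hts h)
      simp [h2, gradient_of_notMem_tsupport hxS, indicator_of_notMem hxS]
  rw [integral_const_mul, integral_add hi hS', h0, zero_add] at hmain
  have h1 := mul_le_mul_of_nonneg_left hmain (by positivity : 0 ≤ 2 / l)
  refine le_trans (le_of_eq ?_) h1
  field_simp
  rfl

end Caccioppoli

/-! ### Smooth cutoff functions -/

section Cutoff

/-- A smooth cutoff function which is `1` near a compact set. -/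
lemma exists_isTest_eq_one {K W : Set (E n)} (hK : IsCompact K) (hW : IsOpen W) (hKW : K ⊆ W) :
    ∃ χ : E n → ℝ, IsTest W χ ∧ (∀ x, 0 ≤ χ x) ∧ (∀ x, χ x ≤ 1) ∧
      ∃ N : Set (E n), IsOpen N ∧ K ⊆ N ∧ ∀ x ∈ N, χ x = 1 := by
  obtain ⟨K', hK', h1, h2⟩ := exists_compact_between hK hW hKW
  obtain ⟨K'', hK'', h3, h4⟩ := exists_compact_between hK' hW h2
  obtain ⟨χ, hχ, hr, hs, h5⟩ := exists_contMDiff_support_eq_eq_one_iff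
    (modelWithCornersSelf ℝ (E n)) (n := ⊤) (isOpen_interior (s := K'')) hK'.isClosed h3
  have hts : tsupport χ ⊆ K'' := by
    rw [tsupport, hs]
    exact closure_minimal interior_subset hK''.isClosed
  exact ⟨χ, ⟨hχ.contDiff, hK''.of_isClosed_subset (isClosed_tsupport _) hts, hts.trans h4⟩,
    fun x => (hr (mem_range_self x)).1, fun x => (hr (mem_range_self x)).2,
    interior K', isOpen_interior, h1, fun x hx => (h5 x).1 (interior_subset hx)⟩

end Cutoff

/-! ### The negative part of the conormal derivative -/

section NegativePart

/-- The negative part of an integrable function is controlled by its integrals against test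
functions with values in `[0, 1]`. -/
lemma integral_negPart_le {σ : Measure (E n)} {g : E n → ℝ} (hg : Integrable g σ)
    {W : Set (E n)} (hW : IsOpen W) (hσ : ∀ᵐ x ∂σ, x ∈ W) {M : ℝ}
    (hM : ∀ ψ, IsTest W ψ → (∀ x, 0 ≤ ψ x) → (∀ x, ψ x ≤ 1) → -∫ x, ψ x * g x ∂σ ≤ M) :
    ∫ x, max (-g x) 0 ∂σ ≤ M := by
  let ν : Measure (E n) := σ.withDensity fun x => ‖g x‖ₑ
  have hν : IsFiniteMeasure ν := isFiniteMeasure_withDensity hg.2.ne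
  let B : Set (E n) := {x | hg.1.mk g x < 0} ∩ W
  have hB : MeasurableSet B :=
    (measurableSet_lt hg.1.stronglyMeasurable_mk.measurable measurable_const).inter
      hW.measurableSet
  refine le_of_forall_pos_le_add fun ε hε => ?_
  have hε4 : ENNReal.ofReal (ε / 4) ≠ 0 := by
    rw [Ne, ENNReal.ofReal_eq_zero, not_le]; positivity
  obtain ⟨K, hKB, hK, hKε⟩ := hB.exists_isCompact_sdiff_lt (measure_ne_top ν B) hε4
  obtain ⟨V, hBV, hV, -, hVε⟩ := hB.exists_isOpen_sdiff_lt (measure_ne_top ν B) hε4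
  obtain ⟨ψ, hψ, hψ0, hψ1, N, -, hKN, hN⟩ := exists_isTest_eq_one hK (hV.inter hW)
    (fun x hx => ⟨hBV (hKB hx), (hKB hx).2⟩)
  have hVK : MeasurableSet (V \ K) := hV.measurableSet.diff hK.measurableSet
  have hsmall : ∫ x, (V \ K).indicator (fun x => ‖g x‖) x ∂σ ≤ ε / 2 := by
    rw [integral_indicator hVK]
    have h1 : ENNReal.ofReal (∫ x in V \ K, ‖g x‖ ∂σ) = ν (V \ K) := by
      rw [ofReal_integral_norm_eq_lintegral_enorm hg.integrableOn, withDensity_apply _ hVK]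
    have h2 : ν (V \ K) ≤ ENNReal.ofReal (ε / 2) := by
      calc ν (V \ K) ≤ ν ((V \ B) ∪ (B \ K)) := measure_mono fun x hx => by
            by_cases hxB : x ∈ B
            · exact Or.inr ⟨hxB, hx.2⟩
            · exact Or.inl ⟨hx.1, hxB⟩
        _ ≤ ν (V \ B) + ν (B \ K) := measure_union_le _ _
        _ ≤ ENNReal.ofReal (ε / 4) + ENNReal.ofReal (ε / 4) := add_le_add hVε.le hKε.le
        _ = ENNReal.ofReal (ε / 2) := by
            rw [← ENNReal.ofReal_add (by positivity) (by positivity)]; congr 1; ring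
    rw [← h1] at h2
    exact (ENNReal.ofReal_le_ofReal_iff (by positivity)).1 h2
  have i1 : Integrable (fun x => ψ x * g x) σ :=
    hg.bdd_mul (c := 1) hψ.1.continuous.aestronglyMeasurable
      (Eventually.of_forall fun x => by rw [Real.norm_of_nonneg (hψ0 x)]; exact hψ1 x)
  have i2 : Integrable ((V \ K).indicator fun x => ‖g x‖) σ := hg.norm.indicator hVK
  -- `ψ` is the indicator function of `{g < 0}` except on `V \ K`, where `|g|` has a small integral
  have hpt : ∫ x, max (-g x) 0 ∂σ ≤
      ∫ x, (-(ψ x * g x) + 2 * (V \ K).indicator (fun x => ‖g x‖) x) ∂σ := by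
    refine integral_mono_ae hg.neg_part (i1.neg.add (i2.const_mul 2)) ?_
    filter_upwards [hσ, hg.1.ae_eq_mk] with x hxW hx
    by_cases hxK : x ∈ K
    · have h1 : g x < 0 := by rw [hx]; exact (hKB hxK).1
      have h2 : x ∉ V \ K := fun h => h.2 hxK
      rw [hN x (hKN hxK), indicator_of_notMem h2, max_eq_left (by linarith)]
      linarith
    · by_cases hxV : x ∈ V
      · rw [indicator_of_mem (show x ∈ V \ K from ⟨hxV, hxK⟩), Real.norm_eq_abs]
        have h1 : |ψ x * g x| ≤ |g x| := by
          rw [abs_mul, abs_of_nonneg (hψ0 x)]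
          exact mul_le_of_le_one_left (abs_nonneg _) (hψ1 x)
        refine max_le ?_ ?_
        · linarith [neg_abs_le (g x), neg_abs_le (ψ x * g x), le_abs_self (ψ x * g x)]
        · linarith [abs_nonneg (g x), le_abs_self (ψ x * g x)]
      · have h1 : ψ x = 0 := image_eq_zero_of_notMem_tsupport fun h => hxV (hψ.2.2 h).1
        have h2 : x ∉ V \ K := fun h => hxV h.1
        have h3 : 0 ≤ g x := by
          by_contra! h
          rw [hx] at h
          exact hxV (hBV ⟨h, hxW⟩)
        rw [h1, indicator_of_notMem h2, max_eq_right (by linarith)]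
        simp
  have h4 := hM ψ ⟨hψ.1, hψ.2.1, hψ.2.2.trans inter_subset_right⟩ hψ0 hψ1
  have h5 := integral_add i1.neg (i2.const_mul 2)
  simp only [Pi.neg_apply] at h5
  rw [h5, integral_const_mul, integral_neg] at hpt
  linarith

variable {D : Set (E n)} {p : ℝ} {A : E n → E n → E n} {φ : E n → ℝ} {m : ℝ}

lemma ae_mem_frontier (D : Set (E n)) : ∀ᵐ x ∂(surface D), x ∈ frontier D :=
  ae_restrict_mem isClosed_frontier.measurableSet

/-- Around `closure D` there is a cutoff function whose gradient pairs boundedly with the fluxes of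
all potentials. -/
lemma exists_cutoff_bound (hn : 1 ≤ n) (hp : 1 < p) (hD : IsOpen D)
    (hDb : Bornology.IsBounded D)
    (hA : IsDegenerateElliptic D p A) (hm : 0 ≤ m) (hφ : ∀ x ∈ frontier D, 0 < φ x)
    (hφm : ∀ x ∈ frontier D, φ x ≤ m) {O : Set (E n)} (hO : IsConfiguration D O) :
    ∃ (χ : E n → ℝ) (N : Set (E n)) (C : ℝ), IsTest O χ ∧ (∀ x, 0 ≤ χ x) ∧ IsOpen N ∧
      closure D ⊆ N ∧ (∀ x ∈ N, χ x = 1) ∧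
      ∀ (Ω : Set (E n)) (u : E n → ℝ) (G : E n → E n), IsConfiguration D Ω →
        IsPotential D p A φ Ω u G →
        ∫ x in exterior D, |inner ℝ (A x (G x)) (∇ χ x)| ≤ C := by
  obtain ⟨l, L, hl, hlL, hell⟩ := hA.elliptic
  have hL : 0 ≤ L := hl.le.trans hlL
  obtain ⟨χ, hχ, hχ0, -, N, hN, hDN, hN1⟩ :=
    exists_isTest_eq_one hDb.isCompact_closure hO.isOpen hO.closure_subset
  obtain ⟨B, -, hB⟩ := exists_bound_of_isTest hχ
  have hB0 : 0 ≤ B := (norm_nonneg _).trans (hB 0)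
  have hKc : IsCompact (tsupport χ \ N) := hχ.2.1.isCompact.diff hN
  obtain ⟨ξ, hξ, hξ0, hξ1, N', -, hKN', hN'⟩ := exists_isTest_eq_one hKc (isOpen_exterior D)
    (fun x hx h => hx.2 (hDN h))
  obtain ⟨M, hM⟩ := exists_nat_ge p
  obtain ⟨C, hC⟩ := exists_bound_integral_pow_mul_rpow hn hp hD hA hm hφ hφm hξ hξ0 hξ1 hM
  let μ : Measure (E n) := volume.restrict (exterior D)
  have hξN : IsTest (exterior D) (fun x => ξ x ^ M) := by
    have hts := tsupport_pow_subset ξ (N := M) (by rintro rfl; norm_num at hM; linarith)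
    exact ⟨hξ.1.pow M, hξ.2.1.of_isClosed_subset (isClosed_tsupport _) hts, hts.trans hξ.2.2⟩
  have hξi : Integrable (fun x => ξ x ^ M) μ :=
    hξN.1.continuous.integrable_of_hasCompactSupport hξN.2.1
  refine ⟨χ, N, L * B * ((∫ x, ξ x ^ M ∂μ) + C), hχ, hχ0, hN, hDN, hN1, fun Ω u G hΩ hu => ?_⟩
  obtain ⟨hi, hle⟩ := hC Ω u G hΩ hu
  have hLB : 0 ≤ L * B := mul_nonneg hL hB0
  refine le_trans ?_ (mul_le_mul_of_nonneg_left (add_le_add_right hle _) hLB)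
  rw [← integral_add hξi hi, ← integral_const_mul]
  refine integral_mono_ae (integrable_inner_gradient_of_isTest hp
    (hA.memLp_comp hp hu.memSobolev.memLp_grad) hχ).abs ((hξi.add hi).const_mul _) ?_
  filter_upwards [hell] with x hx
  -- `∇χ` vanishes near `D`, and elsewhere on its support `ξ = 1`
  by_cases hxg : ∇ χ x = 0
  · have h1 : 0 ≤ ξ x ^ M + ξ x ^ M * ‖G x‖ ^ p :=
      add_nonneg (pow_nonneg (hξ0 x) _) (mul_nonneg (pow_nonneg (hξ0 x) _) (by positivity))
    simpa [hxg] using mul_nonneg hLB h1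
  · have hxN : x ∉ N := by
      intro h
      refine hxg ?_
      have h1 : χ =ᶠ[𝓝 x] fun _ => 1 := by
        filter_upwards [hN.mem_nhds h] with y hy using hN1 y hy
      rw [h1.gradient_eq, gradient_one]
    have hxs : x ∈ tsupport χ := by
      by_contra h
      exact hxg (gradient_of_notMem_tsupport h)
    have h1 : ξ x = 1 := hN' x (hKN' ⟨hxs, hxN⟩)
    have h2 : ‖G x‖ ^ (p - 1) ≤ 1 + ‖G x‖ ^ p := by
      rcases le_or_gt ‖G x‖ 1 with h | h
      · have := Real.rpow_le_one (norm_nonneg (G x)) h (by linarith : 0 ≤ p - 1)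
        have h3 : 0 ≤ ‖G x‖ ^ p := by positivity
        linarith
      · have := Real.rpow_le_rpow_of_exponent_le h.le (by linarith : p - 1 ≤ p)
        linarith
    simp only [h1, one_pow, one_mul]
    calc |(inner ℝ (A x (G x)) (∇ χ x) : ℝ)| ≤ ‖A x (G x)‖ * ‖∇ χ x‖ := abs_real_inner_le_norm _ _
      _ ≤ L * ‖G x‖ ^ (p - 1) * B := mul_le_mul (hx (G x)).2 (hB x) (norm_nonneg _) (by positivity)
      _ = L * B * ‖G x‖ ^ (p - 1) := by ring
      _ ≤ _ := mul_le_mul_of_nonneg_left h2 hLB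

/-- If some configuration has a conormal derivative in `L¹`, then the negative parts of all
conormal derivatives are bounded in `L¹`, independently of the configuration. -/
lemma exists_bound_integral_negPart (hn : 1 ≤ n) (hp : 1 < p) (hD : IsOpen D)
    (hDb : Bornology.IsBounded D)
    (hA : IsDegenerateElliptic D p A) (hm : 0 ≤ m) (hφ : ∀ x ∈ frontier D, 0 < φ x)
    (hφm : ∀ x ∈ frontier D, φ x ≤ m) {O : Set (E n)} {v : E n → ℝ} {H : E n → E n}
    {g₀ : E n → ℝ} (hO : IsConfiguration D O) (hv : IsPotential D p A φ O v H)
    (hg₀ : IsConormalDerivative D A O H g₀) :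
    ∃ C : ℝ, ∀ (Ω : Set (E n)) (u : E n → ℝ) (G : E n → E n) (g : E n → ℝ),
      IsConfiguration D Ω → IsPotential D p A φ Ω u G → IsConormalDerivative D A Ω G g →
      ∫ x, max (-g x) 0 ∂(surface D) ≤ C := by
  obtain ⟨χ, N, C, hχ, hχ0, hN, hDN, hN1, hC⟩ :=
    exists_cutoff_bound hn hp hD hDb hA hm hφ hφm hO
  refine ⟨2 * C + ∫ x, |g₀ x| ∂(surface D), fun Ω u G g hΩ hu hg => ?_⟩
  refine integral_negPart_le hg.integrable ((hΩ.isOpen.inter hO.isOpen).inter hN) ?_ ?_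
  · filter_upwards [ae_mem_frontier D] with x hx
    have hx' := frontier_subset_closure hx
    exact ⟨⟨hΩ.closure_subset hx', hO.closure_subset hx'⟩, hDN hx'⟩
  · intro ψ hψ hψ0 hψ1
    have hYG := hA.memLp_comp hp hu.memSobolev.memLp_grad
    have hYH := hA.memLp_comp hp hv.memSobolev.memLp_grad
    have k1 := hu.neg_integral_abs_le hn hp hD hA hm hφ hφm hΩ hO hv (ψ := ψ) (χ := χ)
      ⟨hψ.1, hψ.2.1, hψ.2.2.trans inter_subset_left⟩ hψ0 hχ (fun x => by
        by_cases hx : x ∈ tsupport ψ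
        · rw [hN1 x (hψ.2.2 hx).2]; exact hψ1 x
        · rw [image_eq_zero_of_notMem_tsupport hx]; exact hχ0 x)
    have k2 : ∫ x in exterior D, |inner ℝ (A x (G x) - A x (H x)) (∇ χ x)| ≤ 2 * C := by
      have i1 := (integrable_inner_gradient_of_isTest hp hYG hχ).abs
      have i2 := (integrable_inner_gradient_of_isTest hp hYH hχ).abs
      have h1 : ∫ x in exterior D, |inner ℝ (A x (G x) - A x (H x)) (∇ χ x)| ≤
          ∫ x in exterior D, (|inner ℝ (A x (G x)) (∇ χ x)| +
            |inner ℝ (A x (H x)) (∇ χ x)|) := by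
        refine integral_mono (integrable_inner_gradient_of_isTest hp (hYG.sub hYH) hχ).abs
          (i1.add i2) fun x => ?_
        simp only [inner_sub_left]
        exact abs_sub _ _
      rw [integral_add i1 i2] at h1
      linarith [hC Ω u G hΩ hu, hC O v H hO hv]
    have k3 : ∫ x in exterior D, inner ℝ (A x (G x) - A x (H x)) (∇ ψ x) =
        (∫ x, ψ x * g x ∂(surface D)) - ∫ x, ψ x * g₀ x ∂(surface D) := by
      rw [← hg.divergence ψ ⟨hψ.1, hψ.2.1, hψ.2.2.trans (inter_subset_left.trans
          inter_subset_left)⟩,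
        ← hg₀.divergence ψ ⟨hψ.1, hψ.2.1, hψ.2.2.trans (inter_subset_left.trans
          inter_subset_right)⟩,
        ← integral_sub (integrable_inner_gradient_of_isTest hp hYG hψ)
          (integrable_inner_gradient_of_isTest hp hYH hψ)]
      simp only [inner_sub_left]
    have k4 : -∫ x, ψ x * g₀ x ∂(surface D) ≤ ∫ x, |g₀ x| ∂(surface D) := by
      have i1 : Integrable (fun x => ψ x * g₀ x) (surface D) :=
        hg₀.integrable.bdd_mul (c := 1) hψ.1.continuous.aestronglyMeasurable
          (Eventually.of_forall fun x => by rw [Real.norm_of_nonneg (hψ0 x)]; exact hψ1 x)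
      rw [← integral_neg]
      refine integral_mono i1.neg hg₀.integrable.abs fun x => ?_
      refine (neg_le_abs _).trans ?_
      rw [abs_mul, abs_of_nonneg (hψ0 x)]
      exact mul_le_of_le_one_left (abs_nonneg _) (hψ1 x)
    linarith

end NegativePart

/-! ### Coercivity of the nonlinearity -/

section Nonlinearity

variable {D : Set (E n)} {Γ : E n → ℝ → ℝ}

lemma deriv_mul_sub_le_of_convexOn {f : ℝ → ℝ} (hf : ConvexOn ℝ univ f) (hd : Differentiable ℝ f)
    (s t : ℝ) : deriv f s * (t - s) ≤ f t - f s := by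
  rcases lt_trichotomy s t with h | h | h
  · have h1 := hf.deriv_le_slope (mem_univ s) (mem_univ t) h (hd s)
    rw [slope_def_field, le_div_iff₀ (sub_pos.2 h)] at h1
    exact h1
  · simp [h]
  · have h1 := hf.slope_le_deriv (mem_univ t) (mem_univ s) h (hd s)
    rw [slope_def_field, div_le_iff₀ (sub_pos.2 h)] at h1
    linarith

lemma IsNonlinearity.deriv_pos (hΓ : IsNonlinearity D Γ) {x : E n} (hx : x ∈ frontier D) (t : ℝ) :
    0 < deriv (Γ x) t := by
  have h1 := deriv_mul_sub_le_of_convexOn (hΓ.convex x hx) (hΓ.differentiable x hx) t (t - 1)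
  have h2 := hΓ.strictMono x hx (by linarith : t - 1 < t)
  linarith

lemma IsNonlinearity.exists_lower_bound_zero (hΓ : IsNonlinearity D Γ) :
    ∃ M : ℝ, 0 ≤ M ∧ ∀ x ∈ frontier D, -M ≤ Γ x 0 := by
  obtain ⟨L, hL, h⟩ := hΓ.ratio
  by_cases hneg : ∃ x ∈ frontier D, Γ x 0 < 0
  · obtain ⟨x, hx, hx0⟩ := hneg
    refine ⟨L * -Γ x 0, mul_nonneg hL.le (by linarith), fun y hy => ?_⟩
    have h1 := h x hx y hy 0 hx0.ne
    rw [div_le_iff_of_neg hx0] at h1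
    linarith
  · push Not at hneg
    exact ⟨0, le_rfl, fun x hx => by simpa using hneg x hx⟩

/-- A coercivity estimate for increments of the nonlinearity. It compares with the value at `s`
rather than at `0`, so that all the terms are integrable on `∂D` when `s` and `Γ(x, s)` are. -/
lemma IsNonlinearity.exists_coercive (hDb : Bornology.IsBounded D) (hΓ : IsNonlinearity D Γ) :
    ∃ c b b' : ℝ, 0 < c ∧ 0 ≤ b ∧ 0 ≤ b' ∧ ∀ x ∈ frontier D, ∀ s t : ℝ,
      c * max t 0 ≤ Γ x t - Γ x s + (b * max (-t) 0 + (b' * |s| + |Γ x s|)) := by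
  have hK : IsCompact (frontier D) :=
    hDb.isCompact_closure.of_isClosed_subset isClosed_frontier frontier_subset_closure
  obtain ⟨c, hc, hcl⟩ := hK.exists_forall_le' (hΓ.continuousOn_deriv 0)
    (fun x hx => hΓ.deriv_pos hx 0)
  obtain ⟨b, hb⟩ := hK.exists_bound_of_continuousOn (hΓ.continuousOn_deriv 0)
  obtain ⟨b₁, hb₁⟩ := hK.exists_bound_of_continuousOn (hΓ.continuousOn_deriv 1)
  obtain ⟨M, hM0, hM⟩ := hΓ.exists_lower_bound_zero
  refine ⟨c, max b 0, max b₁ 0 + M, hc, le_max_right _ _, add_nonneg (le_max_right _ _) hM0,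
    fun x hx s t => ?_⟩
  have h1 : c * max t 0 - max b 0 * max (-t) 0 ≤ Γ x t - Γ x 0 := by
    have h2 := deriv_mul_sub_le_of_convexOn (hΓ.convex x hx) (hΓ.differentiable x hx) 0 t
    rw [sub_zero] at h2
    refine le_trans ?_ h2
    rcases le_total 0 t with ht | ht
    · rw [max_eq_left ht, max_eq_right (neg_nonpos.2 ht), mul_zero, sub_zero]
      exact mul_le_mul_of_nonneg_right (hcl x hx) ht
    · rw [max_eq_right ht, max_eq_left (neg_nonneg.2 ht), mul_zero, zero_sub]
      have h3 : deriv (Γ x) 0 ≤ max b 0 := (le_abs_self _).trans ((hb x hx).trans (le_max_left _ _))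
      nlinarith
  have h2 : -((max b₁ 0 + M) * |s|) - |Γ x s| ≤ Γ x 0 - Γ x s := by
    have hMs : 0 ≤ M * |s| := mul_nonneg hM0 (abs_nonneg _)
    have hbs : 0 ≤ max b₁ 0 * |s| := mul_nonneg (le_max_right _ _) (abs_nonneg _)
    -- for `s ≤ 1` the slope at `s` is bounded; for `s > 1` the constant `M` is at most `M |s|`
    rcases le_or_gt s 1 with hs | hs
    · have h3 := deriv_mul_sub_le_of_convexOn (hΓ.convex x hx) (hΓ.differentiable x hx) s 0
      have h4 : deriv (Γ x) s ≤ deriv (Γ x) 1 :=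
        (hΓ.convex x hx).monotoneOn_deriv (fun t _ => hΓ.differentiable x hx t) (mem_univ s)
          (mem_univ 1) hs
      have h5 : deriv (Γ x) 1 ≤ max b₁ 0 :=
        (le_abs_self _).trans ((hb₁ x hx).trans (le_max_left _ _))
      have h6 : deriv (Γ x) s * s ≤ max b₁ 0 * |s| :=
        (mul_le_mul_of_nonneg_left (le_abs_self s) (hΓ.deriv_pos hx s).le).trans
          (mul_le_mul_of_nonneg_right (h4.trans h5) (abs_nonneg _))
      have h8 := abs_nonneg (Γ x s)
      nlinarith
    · have h3 : M ≤ M * |s| := le_mul_of_one_le_right hM0 (hs.le.trans (le_abs_self s))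
      have h4 := hM x hx
      have h5 := le_abs_self (Γ x s)
      nlinarith
  linarith

end Nonlinearity

/-! ### The energy identity -/

section Energy

variable {D Ω : Set (E n)} {p : ℝ} {A : E n → E n → E n} {φ u g : E n → ℝ} {G : E n → E n}

/-- The energy identity: testing with the potential itself leaves the boundary term. -/
lemma IsPotential.integral_inner_self (hp : 1 < p) (hD : IsOpen D)
    (hA : IsDegenerateElliptic D p A) (hΩ : IsConfiguration D Ω) (hu : IsPotential D p A φ Ω u G)
    (hg : IsConormalDerivative D A Ω G g) :
    Integrable (fun x => inner ℝ (A x (G x)) (G x)) (volume.restrict (exterior D)) ∧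
    Integrable (fun x => φ x * g x) (surface D) ∧
    ∫ x in exterior D, inner ℝ (A x (G x)) (G x) = ∫ x, φ x * g x ∂(surface D) := by
  have := holderTriple_conjExponent hp
  obtain ⟨U, hU⟩ := hu.exists_isApprox hp hD hΩ
  have hY := hA.memLp_comp hp hu.memSobolev.memLp_grad
  obtain ⟨hi, hlim⟩ := tendsto_integral_inner_gradient_outer
    Measure.restrict_le_self.absolutelyContinuous hY isOuter_fst (ζ := fun _ => 1) (B := 1)
    contDiff_const (by simp) (by simp [gradient_one]) hU.toGradApprox hU.toGradApprox
  simp only [outerGrad_one, one_smul, zero_smul, add_zero, one_mul] at hi hlim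
  have hae : ∀ k, (fun x => U k x * g x) =ᵐ[surface D] fun x => φ x * g x := fun k => by
    filter_upwards [ae_mem_frontier D] with x hx
    rw [hU.boundary k x hx]
  have hUg : Integrable (fun x => U 0 x * g x) (surface D) := by
    obtain ⟨K, hK⟩ := hU.lip 0
    obtain ⟨B, hB⟩ := (hU.compact 0).exists_bound_of_continuous hK.continuous
    exact hg.integrable.bdd_mul hK.continuous.aestronglyMeasurable (Eventually.of_forall hB)
  refine ⟨hi, hUg.congr (hae 0), tendsto_nhds_unique hlim (tendsto_const_nhds.congr fun k => ?_)⟩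
  obtain ⟨K, hK⟩ := hU.lip k
  rw [← integral_congr_ae (hae k)]
  exact (integral_inner_gradient_eq_of_lipschitz hΩ.isOpen
    (fun S hS => integrableOn_of_memLp_of_isCompact hY (one_le_conjExponent hp) hS) hg.integrable
    hg.divergence hK (hU.compact k) (hU.tsupport_subset k)).symm

end Energy

end OptimalDesign

theorem mainTheorem12 {n : ℕ} (hn : 1 ≤ n) (p : ℝ) (hp : 1 < p)
    (D : Set (OptimalDesign.E n)) (hD : OptimalDesign.IsLipschitzDomain D)
    (φ : OptimalDesign.E n → ℝ) (hφ_pos : ∀ x ∈ frontier D, 0 < φ x)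
    (hφ_lip : ∃ K : ℝ≥0, LipschitzOnWith K φ (frontier D))
    (ι : ℝ) (hι : 0 < ι)
    (A : OptimalDesign.E n → OptimalDesign.E n → OptimalDesign.E n)
    (hA : OptimalDesign.IsDegenerateElliptic D p A)
    (Γ : OptimalDesign.E n → ℝ → ℝ) (hΓ : OptimalDesign.IsNonlinearity D Γ)
    (hfinite : ∃ (O : Set (OptimalDesign.E n)) (j : ℝ),
      OptimalDesign.HasFlux D p A φ Γ O j ∧ volume (O \ D) ≤ ENNReal.ofReal ι) :
    ∃ C : ℝ, 0 < C ∧ ∀ lam : ℝ, 0 < lam → ∀ Ω : Set (OptimalDesign.E n),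
      OptimalDesign.IsOptimal D p A φ Γ ι lam Ω →
      ∀ (u : OptimalDesign.E n → ℝ) (G : OptimalDesign.E n → OptimalDesign.E n),
        OptimalDesign.IsPotential D p A φ Ω u G →
        ∫⁻ x in OptimalDesign.exterior D, ‖G x‖ₑ ^ p < ENNReal.ofReal C := by
  open OptimalDesign in
  obtain ⟨O, j₀, hflux, hvol⟩ := hfinite
  obtain ⟨hO, v, H, g₀, hv, hg₀, hΓ₀, hj₀⟩ := id hflux
  have hK : IsCompact (frontier D) :=
    hD.isBounded.isCompact_closure.of_isClosed_subset isClosed_frontier frontier_subset_closure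
  obtain ⟨Kφ, hKφ⟩ := hφ_lip
  obtain ⟨m', hm'⟩ := hK.exists_bound_of_continuousOn hKφ.continuousOn
  let m : ℝ := max m' 0
  have hm : 0 ≤ m := le_max_right _ _
  have hφm : ∀ x ∈ frontier D, φ x ≤ m := fun x hx =>
    (le_abs_self _).trans ((hm' x hx).trans (le_max_left _ _))
  obtain ⟨l, L, hl, hlL, hell⟩ := hA.elliptic
  obtain ⟨C₁, hC₁⟩ := exists_bound_integral_negPart hn hp hD.isOpen hD.isBounded hA hm hφ_pos hφm
    hO hv hg₀
  obtain ⟨c, b, b', hc, hb, hb', hco⟩ := hΓ.exists_coercive hD.isBounded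
  let R₀ : ℝ := ∫ x, (b' * |g₀ x| + |Γ x (g₀ x)|) ∂(surface D)
  let R : ℝ := l⁻¹ * (m * (c⁻¹ * (b * C₁ + R₀)))
  refine ⟨max R 0 + 1, by positivity, fun lam hlam Ω hΩopt u G hu => ?_⟩
  obtain ⟨j, ⟨hΩ, u', G', g, hu', hg, hΓg, hj⟩, hopt⟩ := hΩopt
  -- the competitor `O` pays no penalty, so its flux bounds that of `Ω` independently of `lam`
  have hjj : j ≤ j₀ := by
    have h1 := hopt O j₀ hflux
    have h2 : (volume (O \ D)).toReal ≤ ι := ENNReal.toReal_le_of_le_ofReal hι.le hvol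
    have h3 : penalty lam ι (volume (O \ D)).toReal = 0 := by
      rw [penalty, max_eq_right (by linarith), mul_zero]
    have h4 : 0 ≤ penalty lam ι (volume (Ω \ D)).toReal :=
      mul_nonneg hlam.le (le_max_right _ _)
    linarith
  have hpos : ∫ x, max (g x) 0 ∂(surface D) ≤ c⁻¹ * (b * C₁ + R₀) := by
    have i1 : Integrable (fun x => b' * |g₀ x| + |Γ x (g₀ x)|) (surface D) :=
      (hg₀.integrable.abs.const_mul b').add hΓ₀.abs
    have i2 : Integrable (fun x => b * max (-g x) 0) (surface D) :=
      hg.integrable.neg_part.const_mul b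
    have h1 : ∫ x, c * max (g x) 0 ∂(surface D) ≤ ∫ x, (Γ x (g x) - Γ x (g₀ x) +
        (b * max (-g x) 0 + (b' * |g₀ x| + |Γ x (g₀ x)|))) ∂(surface D) := by
      refine integral_mono_ae (hg.integrable.pos_part.const_mul c)
        ((hΓg.sub hΓ₀).add (i2.add i1)) ?_
      filter_upwards [ae_mem_frontier D] with x hx
      exact hco x hx (g₀ x) (g x)
    have e1 := integral_add (hΓg.sub hΓ₀) (i2.add i1)
    have e2 := integral_sub hΓg hΓ₀
    have e3 := integral_add i2 i1
    simp only [Pi.add_apply, Pi.sub_apply] at e1 e2 e3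
    rw [e1, e2, e3, integral_const_mul, integral_const_mul, ← hj, ← hj₀] at h1
    have h2 := mul_le_mul_of_nonneg_left (hC₁ Ω u' G' g hΩ hu' hg) hb
    rw [inv_mul_eq_div, le_div_iff₀ hc]
    have h3 : R₀ = ∫ x, (b' * |g₀ x| + |Γ x (g₀ x)|) ∂(surface D) := rfl
    linarith
  obtain ⟨i1, i2, henergy⟩ := hu'.integral_inner_self hp hD.isOpen hA hΩ hg
  have hGp : Integrable (fun x => ‖G' x‖ ^ p) (volume.restrict (exterior D)) := by
    have := hu'.memSobolev.memLp_grad.integrable_norm_rpow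
      (zero_lt_one.trans_le (one_le_ofReal hp)).ne' ENNReal.ofReal_ne_top
    rwa [ENNReal.toReal_ofReal (by linarith)] at this
  have hbound : ∫ x in exterior D, ‖G' x‖ ^ p ≤ R := by
    have h1 : l * ∫ x in exterior D, ‖G' x‖ ^ p ≤
        ∫ x in exterior D, inner ℝ (A x (G' x)) (G' x) := by
      rw [← integral_const_mul]
      refine integral_mono_ae (hGp.const_mul l) i1 ?_
      filter_upwards [hell] with x hx
      exact (hx (G' x)).1
    have h2 : ∫ x, φ x * g x ∂(surface D) ≤ m * ∫ x, max (g x) 0 ∂(surface D) := by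
      rw [← integral_const_mul]
      refine integral_mono_ae i2 (hg.integrable.pos_part.const_mul m) ?_
      filter_upwards [ae_mem_frontier D] with x hx
      calc φ x * g x ≤ φ x * max (g x) 0 :=
            mul_le_mul_of_nonneg_left (le_max_left _ _) (hφ_pos x hx).le
        _ ≤ m * max (g x) 0 := mul_le_mul_of_nonneg_right (hφm x hx) (le_max_right _ _)
    have h3 := mul_le_mul_of_nonneg_left hpos hm
    simp only [R]
    rw [inv_mul_eq_div, le_div_iff₀ hl]
    linarith
  -- the potential that carries the conormal derivative need not be `u` itself
  have hGG := hu.ae_grad_eq hn hp hD.isOpen hA hΩ hu'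
  calc ∫⁻ x in exterior D, ‖G x‖ₑ ^ p = ∫⁻ x in exterior D, ENNReal.ofReal (‖G' x‖ ^ p) := by
        refine lintegral_congr_ae ?_
        filter_upwards [hGG] with x hx
        rw [hx, ← ENNReal.ofReal_rpow_of_nonneg (norm_nonneg _) (by linarith), ofReal_norm]
    _ = ENNReal.ofReal (∫ x in exterior D, ‖G' x‖ ^ p) :=
        (ofReal_integral_eq_lintegral_ofReal hGp
          (Eventually.of_forall fun x => Real.rpow_nonneg (norm_nonneg _) _)).symm
    _ < ENNReal.ofReal (max R 0 + 1) := by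
        refine (ENNReal.ofReal_lt_ofReal_iff (by positivity)).2 ?_
        linarith [le_max_left R 0]
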